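/- Let $k\ge 3$, let $\mathcal H_1,\dots,\mathcal H_k$ be complex Hilbert spaces (of any dimension), and let $S\subseteq\mathcal H_1\otimes\cdots\otimes\mathcal H_k$ be a three-dimensional subspace. A product state is a unit vector of the form $\phi^{(1)}\otimes\cdots\otimes\phi^{(k)}$. Let $S_{\rm sep}$ be the span of all product states in $S$. For a finite-dimensional subspace $T$ let $\mathcal D(T)$ be the set of density operators (positive semidefinite, trace $1$) on $T$, extended by zero to $T^\perp$. Let $\mathcal D^S_{\rm sep}$ be the set of all $\rho\in\mathcal D(S)$ that are fully separable, i.e. convex combinations of operators $|\psi\rangle\langle\psi|$ with $\psi$ a product state. States are called equal if they agree up to a global phase. (A) If $\dim S_{\rm sep}\le 2$, then one of the following five classes occurs (the multipartite version of the Boyer–Liss–Mor classification). (1) $\dim S_{\rm sep}=2$ and $S_{\rm sep}$ is a local qubit: it is spanned by two product states $\alpha_1^{(1)}\otimes\cdots\otimes\alpha_1^{(k)}$, $\alpha_2^{(1)}\otimes\cdots\otimes\alpha_2^{(k)}$ that are equal in all subsystems but one, $\ell$, so that $S_{\rm sep}=\operatorname{span}\{\alpha_1^{(\ell)},\alpha_2^{(\ell)}\}\otimes\{\bigotimes_{j\ne\ell}\alpha_1^{(j)}\}$;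 all its pure states are product states, and $\mathcal D^S_{\rm sep}=\mathcal D(S_{\rm sep})$. (2), (3) $\dim S_{\rm sep}=2$, $S_{\rm sep}$ is spanned by two product states $\Phi_1,\Phi_2$ (orthogonal in class (2), non-orthogonal in class (3)) whose local vectors are linearly independent in at least two subsystems, and $\mathcal D^S_{\rm sep}=\operatorname{conv}\{|\Phi_1\rangle\langle\Phi_1|,|\Phi_2\rangle\langle\Phi_2|\}$. (4) $\dim S_{\rm sep}=1$, $S$ contains exactly one product state $\Phi$ up to phase, and $\mathcal D^S_{\rm sep}=\{|\Phi\rangle\langle\Phi|\}$. (5) $\dim S_{\rm sep}=0$, $S$ contains no product state, and $\mathcal D^S_{\rm sep}=\emptyset$. (B) If $\dim S_{\rm sep}=3$, then $S_{\rm sep}=S$, and $S$ is spanned by three product states $\Phi_i=\alpha_i^{(1)}\otimes\cdots\otimes\alpha_i^{(k)}$, $i=1,2,3$, with unit vectors $\alpha_i^{(j)}$. For every such choice for which all local spans $\operatorname{span}\{\alpha_1^{(j)},\alpha_2^{(j)},\alpha_3^{(j)}\}$, $1\le j\le k$, have dimension $2$ or $3$, one of the following two cases occurs. (Triangle) $\mathcal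 D^S_{\rm sep}=\operatorname{conv}\{|\Phi_1\rangle\langle\Phi_1|,|\Phi_2\rangle\langle\Phi_2|,|\Phi_3\rangle\langle\Phi_3|\}$. (Spherical cone) There are $\ell\in\{1,\dots,k\}$ and $\{a,b,c\}=\{1,2,3\}$ such that the states $\bigotimes_{j\neq\ell}\alpha_b^{(j)}$ and $\bigotimes_{j\neq\ell}\alpha_c^{(j)}$ are equal and $$\mathcal D^S_{\rm sep}=\operatorname{conv}\Big[\{|\Phi_a\rangle\langle\Phi_a|\}\cup\mathcal D\Big(\operatorname{span}\{\alpha_b^{(\ell)},\alpha_c^{(\ell)}\}\otimes\Big\{\bigotimes_{j\ne\ell}\alpha_b^{(j)}\Big\}\Big)\Big].$$ Moreover, in the situation of (B), the two shapes that $\mathcal D_{\rm sep}^S$ has in the bipartite classes (2,2)-i and (2,2)-ii never occur: $\mathcal D^S_{\rm sep}$ is not of the form $\operatorname{conv}[\mathcal D(S_1)\cup\mathcal D(S_2)]$ with two-dimensional subspaces $S_1,S_2$ of $\mathcal H_1\otimes\cdots\otimes\mathcal H_k$, and there are no partition of the subsystems into two parts $X,Y$, two-dimensional subspace $V\subseteq\bigotimes_{j\in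 X}\mathcal H_j$ and injective linear map $L:V\to\bigotimes_{j\in Y}\mathcal H_j$ such that $\mathcal D^S_{\rm sep}=\operatorname{conv}\{|\Psi\rangle\langle\Psi| : \Psi=\gamma\,\psi\otimes L\psi,\ \psi\in V,\ \gamma\in\mathbb C,\ \|\Psi\|=1\}$. -/

import Mathlib

noncomputable section

namespace Multipartite

/-- The Hilbert space `ℓ²(κ, ℂ)` with orthonormal basis indexed by `κ`. Every complex Hilbert space,
of any finite or infinite dimension, is of this form after the choice of an orthonormal basis. -/
abbrev Hilb (κ : Type*) : Type _ := lp (fun _ : κ => ℂ) 2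

/-- The Hilbert tensor product `⨂ j, ℓ²(ι j)`, realised as `ℓ²(Π j, ι j)`: if `e j a` (`a : ι j`) is
the orthonormal basis of the `j`-th factor, then the tensors `⨂ j, e j (a j)` are the orthonormal
basis of the tensor product. -/
abbrev HilbTensor {J : Type*} (ι : J → Type*) : Type _ := Hilb (∀ j, ι j)

section Products

variable {J : Type*} {ι : J → Type*}

theorem summable_prod_apply [Fintype J] (f : ∀ j, ι j → ℝ) (h0 : ∀ j x, 0 ≤ f j x)
    (hf : ∀ j, Summable (f j)) : Summable fun a : (∀ j, ι j) => ∏ j, f j (a j) := by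
  classical
  refine summable_of_sum_le (c := ∏ j, ∑' x, f j x)
    (fun a => Finset.prod_nonneg fun j _ => h0 j _) fun s => ?_
  have hsub : s ⊆ Fintype.piFinset fun j => s.image fun a => a j := by
    intro a ha
    rw [Fintype.mem_piFinset]
    exact fun j => Finset.mem_image_of_mem _ ha
  calc ∑ a ∈ s, ∏ j, f j (a j)
      ≤ ∑ a ∈ Fintype.piFinset (fun j => s.image fun a => a j), ∏ j, f j (a j) :=
        Finset.sum_le_sum_of_subset_of_nonneg hsub fun a _ _ =>
          Finset.prod_nonneg fun j _ => h0 j _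
    _ = ∏ j, ∑ x ∈ s.image (fun a => a j), f j x := (Finset.prod_univ_sum _ _).symm
    _ ≤ ∏ j, ∑' x, f j x :=
        Finset.prod_le_prod (fun j _ => Finset.sum_nonneg fun x _ => h0 j x) fun j _ =>
          (hf j).sum_le_tsum _ fun x _ => h0 j x

theorem memℓp_prod [Fintype J] (φ : ∀ j, Hilb (ι j)) :
    Memℓp (fun a : (∀ j, ι j) => ∏ j, (φ j : ι j → ℂ) (a j)) 2 := by
  refine memℓp_gen ?_
  have h := summable_prod_apply (fun j x => ‖(φ j : ι j → ℂ) x‖ ^ (2 : ENNReal).toReal)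
    (fun j x => Real.rpow_nonneg (norm_nonneg _) _)
    (fun j => (memℓp_gen_iff (by norm_num)).1 (lp.memℓp (φ j)))
  refine h.congr fun a => ?_
  rw [norm_prod, Real.finsetProd_rpow _ _ fun j _ => norm_nonneg _]

/-- The tensor `φ₁ ⊗ ⋯ ⊗ φₖ` of a family of vectors. -/
def productVec [Fintype J] (φ : ∀ j, Hilb (ι j)) : HilbTensor ι :=
  ⟨fun a => ∏ j, (φ j : ι j → ℂ) (a j), memℓp_prod φ⟩

variable (p : J → Prop)

theorem memℓp_cut (u : HilbTensor fun j : {j // p j} => ι j)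
    (v : HilbTensor fun j : {j // ¬ p j} => ι j) :
    Memℓp (fun a : (∀ j, ι j) =>
      (u : (∀ j : {j // p j}, ι j) → ℂ) (fun j => a j) *
      (v : (∀ j : {j // ¬ p j}, ι j) → ℂ) (fun j => a j)) 2 := by
  classical
  have hu := (memℓp_gen_iff (by norm_num)).1 (lp.memℓp u)
  have hv := (memℓp_gen_iff (by norm_num)).1 (lp.memℓp v)
  refine memℓp_gen ?_
  have h := (Equiv.piEquivPiSubtypeProd p ι).summable_iff.2
    (hu.mul_of_nonneg hv (fun x => Real.rpow_nonneg (norm_nonneg _) _)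
      (fun x => Real.rpow_nonneg (norm_nonneg _) _))
  refine h.congr fun a => ?_
  rw [norm_mul, Real.mul_rpow (norm_nonneg _) (norm_nonneg _)]
  rfl

/-- The tensor `u ⊗ v` with respect to a bipartite cut of the set of subsystems: `u` is a vector of
the tensor product of the subsystems in `p`, and `v` of that of the remaining ones. -/
def cutProductVec (u : HilbTensor fun j : {j // p j} => ι j)
    (v : HilbTensor fun j : {j // ¬ p j} => ι j) : HilbTensor ι :=
  ⟨fun a => (u : (∀ j : {j // p j}, ι j) → ℂ) (fun j => a j) *
    (v : (∀ j : {j // ¬ p j}, ι j) → ℂ) (fun j => a j), memℓp_cut p u v⟩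

end Products

section States

variable {E : Type*} [NormedAddCommGroup E] [InnerProductSpace ℂ E]

/-- Two state vectors are equal up to a global phase. -/
def SameState (u v : E) : Prop := ∃ c : ℂ, ‖c‖ = 1 ∧ u = c • v

/-- The operator `|ψ⟩⟨ψ|`. -/
def ketbra (ψ : E) : E →L[ℂ] E := InnerProductSpace.rankOne ℂ ψ ψ

/-- `𝒟(T)`, the density operators (positive semidefinite, trace one) on a finite-dimensional
subspace `T`, regarded as operators on the whole space: a positive operator with range in `T`
vanishes on `Tᗮ`, and the trace is that of its restriction to `T`. -/
def densityOperators (T : Submodule ℂ E) : Set (E →L[ℂ] E) :=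
  {ρ | ρ.IsPositive ∧ ∃ h : ∀ x, (ρ : E →ₗ[ℂ] E) x ∈ T,
    LinearMap.trace ℂ T (((ρ : E →ₗ[ℂ] E).codRestrict T h).comp T.subtype) = 1}

end States

variable {k : ℕ} {ι : Fin k → Type*}

/-- The vector is a (not necessarily normalised) product vector `φ₁ ⊗ ⋯ ⊗ φₖ`. -/
def IsProductVector (ψ : HilbTensor ι) : Prop := ∃ φ : ∀ j, Hilb (ι j), ψ = productVec φ

/-- `S_sep`, the span of the product states in `S`. -/
def sepSpan (S : Submodule ℂ (HilbTensor ι)) : Submodule ℂ (HilbTensor ι) :=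
  Submodule.span ℂ {ψ | ψ ∈ S ∧ IsProductVector ψ}

/-- A fully separable state: a mixture (convex combination) of pure product states. -/
def IsFullySeparable (ρ : HilbTensor ι →L[ℂ] HilbTensor ι) : Prop :=
  ρ ∈ convexHull ℝ {P | ∃ ψ : HilbTensor ι, IsProductVector ψ ∧ ‖ψ‖ = 1 ∧ P = ketbra ψ}

/-- `𝒟_sep^S`, the fully separable states over `S`. -/
def separableStates (S : Submodule ℂ (HilbTensor ι)) :
    Set (HilbTensor ι →L[ℂ] HilbTensor ι) :=
  {ρ | ρ ∈ densityOperators S ∧ IsFullySeparable ρ}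

/-- The subspace `W ⊗ {⨂_{j ≠ ℓ} β j}`, where `W` is a subspace of the `ℓ`-th factor. -/
def localSpace (ℓ : Fin k) (W : Submodule ℂ (Hilb (ι ℓ))) (β : ∀ j, Hilb (ι j)) :
    Submodule ℂ (HilbTensor ι) :=
  Submodule.span ℂ {ψ | ∃ φ ∈ W, ψ = productVec (Function.update β ℓ φ)}

/-- The tensor `⨂_{j ≠ ℓ} β j` of the vectors at all sites but `ℓ`. -/
def productVecOff (ℓ : Fin k) (β : ∀ j, Hilb (ι j)) : HilbTensor (fun j : {j // j ≠ ℓ} => ι j) :=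
  productVec fun j : {j // j ≠ ℓ} => β j

/-! ### The five classes when `S_sep` has dimension at most two -/

/-- The product states over `S` span a local qubit in a single subsystem `ℓ`; all pure states of
that qubit are product states, and the fully separable states over `S` are all its states. -/
def IsLocalQubitClass (S : Submodule ℂ (HilbTensor ι)) : Prop :=
  Module.finrank ℂ (sepSpan S) = 2 ∧
  ∃ α : Fin 2 → ∀ j, Hilb (ι j), (∀ i j, ‖α i j‖ = 1) ∧
    sepSpan S = Submodule.span ℂ (Set.range fun i => productVec (α i)) ∧
    ∃ ℓ : Fin k, (∀ j, j ≠ ℓ → SameState (α 0 j) (α 1 j)) ∧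
      LinearIndependent ℂ (fun i => α i ℓ) ∧
      sepSpan S = localSpace ℓ (Submodule.span ℂ (Set.range fun i => α i ℓ)) (α 0) ∧
      (∀ ψ ∈ sepSpan S, IsProductVector ψ) ∧
      separableStates S = densityOperators (sepSpan S)

/-- `S_sep` is spanned by two product states that differ in at least two subsystems, and the fully
separable states over `S` are exactly the mixtures of these two. -/
def IsSegmentClass (S : Submodule ℂ (HilbTensor ι)) (α : Fin 2 → ∀ j, Hilb (ι j)) : Prop :=
  Module.finrank ℂ (sepSpan S) = 2 ∧ (∀ i j, ‖α i j‖ = 1) ∧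
    sepSpan S = Submodule.span ℂ (Set.range fun i => productVec (α i)) ∧
    (∃ ℓ m : Fin k, ℓ ≠ m ∧ LinearIndependent ℂ (fun i => α i ℓ) ∧
      LinearIndependent ℂ (fun i => α i m)) ∧
    separableStates S = convexHull ℝ (Set.range fun i => ketbra (productVec (α i)))

/-- Segment class with orthogonal end points. -/
def IsOrthogonalSegmentClass (S : Submodule ℂ (HilbTensor ι)) : Prop :=
  ∃ α : Fin 2 → ∀ j, Hilb (ι j), IsSegmentClass S α ∧ inner ℂ (productVec (α 0)) (productVec (α 1)) = 0

/-- Segment class with non-orthogonal end points. -/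
def IsNonorthogonalSegmentClass (S : Submodule ℂ (HilbTensor ι)) : Prop :=
  ∃ α : Fin 2 → ∀ j, Hilb (ι j), IsSegmentClass S α ∧ inner ℂ (productVec (α 0)) (productVec (α 1)) ≠ 0

/-- `S` contains exactly one product state (up to scalars), and this is the only fully separable
state over `S`. -/
def IsSinglePointClass (S : Submodule ℂ (HilbTensor ι)) : Prop :=
  Module.finrank ℂ (sepSpan S) = 1 ∧
  ∃ φ : ∀ j, Hilb (ι j), (∀ j, ‖φ j‖ = 1) ∧ productVec φ ∈ S ∧
    (∀ ψ ∈ S, IsProductVector ψ → ∃ c : ℂ, ψ = c • productVec φ) ∧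
    separableStates S = {ketbra (productVec φ)}

/-- `S` contains no product state, and all states over `S` are entangled. -/
def IsEntangledClass (S : Submodule ℂ (HilbTensor ι)) : Prop :=
  Module.finrank ℂ (sepSpan S) = 0 ∧ (∀ ψ ∈ S, IsProductVector ψ → ψ = 0) ∧
    separableStates S = ∅

/-! ### Shapes of the set of fully separable states when `S_sep = S` -/

/-- Triangle: the fully separable states over `S` are the mixtures of the three product states. -/
def IsTriangle (S : Submodule ℂ (HilbTensor ι)) (α : Fin 3 → ∀ j, Hilb (ι j)) : Prop :=
  separableStates S = convexHull ℝ (Set.range fun i => ketbra (productVec (α i)))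

/-- Spherical cone: for some subsystem `ℓ`, two of the three product states, `b` and `c`, agree on
all the other subsystems, and the fully separable states over `S` are the mixtures of the remaining
product state `a` with the states over the local qubit space
`span {α b ℓ, α c ℓ} ⊗ {⨂_{j ≠ ℓ} α b j}`. -/
def IsSphericalCone (S : Submodule ℂ (HilbTensor ι)) (α : Fin 3 → ∀ j, Hilb (ι j)) : Prop :=
  ∃ ℓ : Fin k, ∃ a b c : Fin 3, a ≠ b ∧ a ≠ c ∧ b ≠ c ∧
    SameState (productVecOff ℓ (α b)) (productVecOff ℓ (α c)) ∧
    separableStates S = convexHull ℝ ({ketbra (productVec (α a))} ∪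
      densityOperators (localSpace ℓ (Submodule.span ℂ {α b ℓ, α c ℓ}) (α b)))

/-- The shape of the bipartite class (2,2)-i: the convex hull of the sets of all states over two
qubit spaces. -/
def IsTwoQubitHull (D : Set (HilbTensor ι →L[ℂ] HilbTensor ι)) : Prop :=
  ∃ S₁ S₂ : Submodule ℂ (HilbTensor ι), Module.finrank ℂ S₁ = 2 ∧ Module.finrank ℂ S₂ = 2 ∧
    D = convexHull ℝ (densityOperators S₁ ∪ densityOperators S₂)

/-- The shape of the bipartite class (2,2)-ii, for some bipartite cut of the set of subsystems: the
mixtures of the pure states `γ • ψ ⊗ L ψ`, where `ψ` ranges over a two-dimensional space `V` of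
vectors of one part and `L` is an injective linear map from `V` to vectors of the other part. -/
def IsSymmetricHull (D : Set (HilbTensor ι →L[ℂ] HilbTensor ι)) : Prop :=
  ∃ (p : Fin k → Prop) (V : Submodule ℂ (HilbTensor fun j : {j // p j} => ι j))
    (L : V →ₗ[ℂ] HilbTensor fun j : {j // ¬ p j} => ι j),
    Module.finrank ℂ V = 2 ∧ Function.Injective L ∧
    D = convexHull ℝ {P | ∃ (ψ : V) (γ : ℂ) (Ψ : HilbTensor ι),
      Ψ = γ • cutProductVec p (ψ : HilbTensor fun j : {j // p j} => ι j) (L ψ) ∧ ‖Ψ‖ = 1 ∧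
      P = ketbra Ψ}

end Multipartite

end

open Multipartite

/-! Everything reduces to locating the product vectors in `S`. If a mixture of pure states has range
in `S`, positivity puts every state of nonzero weight in `S`; so the separable states over `S` are
the convex hull of the pure product states in `S` (`separableStates_eq_convexHull`).

Choose product states spanning `sepSpan S`. A proper combination of two of them is a product only if
their factors are parallel at all sites but one (`parallel_or_parallel_of_add_eq_smul_prodOn`); this
separates the local qubit from the segments.

For three, the crux is `sum_smul_prodOn_ne_prodOn`: a combination with no zero coefficient is never
a product. Suppose it is, and fix a site `l`. If the three products over the other sites are
independent, comparing slices at `l` makes all three factors at `l` parallel, which the local spans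
forbid. If they are dependent, two of the families agree off `l`. Two sites give two such pairs; if
the pairs differed, all three families would agree at a third site. So one pair agrees off each of
two sites, hence everywhere, contradicting independence.

Thus the product vectors of `S` form three lines (triangle) or a line and one local qubit (cone).
Either way they are covered by a line and a subspace `W` not containing it, and this covering alone
excludes the two bipartite shapes. -/

noncomputable section

namespace Multipartite

/-! ### Parallel functions and linear relations between product functions -/

section Functions

variable {J : Type*} {ι : J → Type*}

/-- Two functions are parallel if all `2 × 2` minors of the pair vanish. -/
def Parallel {X : Type*} (u v : X → ℂ) : Prop := ∀ x y, u x * v y = u y * v x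

theorem Parallel.symm {X : Type*} {u v : X → ℂ} (h : Parallel u v) : Parallel v u := fun x y => by
  rw [mul_comm, h y x, mul_comm]

/-- The zero function is parallel to everything, so the middle function must be nonzero. -/
theorem Parallel.trans {X : Type*} {u v w : X → ℂ} (h : Parallel u v) (h' : Parallel v w)
    (hv : v ≠ 0) : Parallel u w := by
  obtain ⟨z, hz⟩ := Function.ne_iff.1 hv
  intro x y
  have hz : v z ≠ 0 := hz
  refine mul_left_cancel₀ (mul_ne_zero hz hz) ?_
  linear_combination (v z * w y) * h x z - v z * w x * h y z + u z * v z * h' x y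

theorem parallel_iff_exists_smul {X : Type*} {u v : X → ℂ} (hv : v ≠ 0) :
    Parallel u v ↔ ∃ c : ℂ, u = c • v := by
  constructor
  · intro h
    obtain ⟨z, hz⟩ := Function.ne_iff.1 hv
    refine ⟨u z / v z, funext fun x => ?_⟩
    have hz : v z ≠ 0 := hz
    have := h x z
    simp only [Pi.smul_apply, smul_eq_mul]
    field_simp
    linear_combination this
  · rintro ⟨c, rfl⟩ x y
    simp only [Pi.smul_apply, smul_eq_mul]
    ring

/-- The product function `a ↦ ∏ j ∈ s, φ j (a j)`. -/
def prodOn (s : Finset J) (φ : ∀ j, ι j → ℂ) (a : ∀ j, ι j) : ℂ := ∏ j ∈ s, φ j (a j)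

variable [DecidableEq J]

theorem prodOn_update {s : Finset J} {l : J} (hl : l ∈ s) (φ : ∀ j, ι j → ℂ) (a : ∀ j, ι j)
    (x : ι l) : prodOn s φ (Function.update a l x) = φ l x * prodOn (s.erase l) φ a := by
  rw [prodOn, ← Finset.mul_prod_erase s _ hl, Function.update_self]
  congr 1
  refine Finset.prod_congr rfl fun j hj => ?_
  rw [Function.update_of_ne (Finset.ne_of_mem_erase hj)]

omit [DecidableEq J] in
theorem exists_prodOn_ne_zero (s : Finset J) {φ : ∀ j, ι j → ℂ} (h : ∀ j, φ j ≠ 0) :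
    ∃ a, prodOn s φ a ≠ 0 := by
  choose a ha using fun j => Function.ne_iff.1 (h j)
  exact ⟨a, Finset.prod_ne_zero_iff.2 fun j _ => ha j⟩

omit [DecidableEq J] in
theorem ne_zero_of_prodOn_ne_zero {s : Finset J} {φ : ∀ j, ι j → ℂ} (h : prodOn s φ ≠ 0)
    {j : J} (hj : j ∈ s) : φ j ≠ 0 := by
  rintro h0
  refine h (funext fun a => ?_)
  exact Finset.prod_eq_zero hj (by rw [h0]; rfl)

/-- If two products of nonzero functions are linearly dependent, then all factors are parallel. -/
theorem parallel_of_smul_prodOn_add_eq_zero {s : Finset J} {φ ψ : ∀ j, ι j → ℂ}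
    (hφ : ∀ j, φ j ≠ 0) (hψ : ∀ j, ψ j ≠ 0) {c d : ℂ} (hc : c ≠ 0 ∨ d ≠ 0)
    (h : c • prodOn s φ + d • prodOn s ψ = 0) {j : J} (hj : j ∈ s) : Parallel (φ j) (ψ j) := by
  have h' : ∀ a, c * prodOn s φ a + d * prodOn s ψ a = 0 := fun a => congrFun h a
  obtain ⟨a, ha⟩ := exists_prodOn_ne_zero s hφ
  obtain ⟨b, hb⟩ := exists_prodOn_ne_zero s hψ
  have hc0 : c ≠ 0 := by
    rintro rfl
    have := h' b
    simp_all
  -- Only the coordinate `j` of `a` varies, so the relation becomes one between `φ j` and `ψ j` with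
  -- constant coefficients; cross-multiplying by values of `ψ j` eliminates the second term.
  have hk := fun x => h' (Function.update a j x)
  simp only [prodOn_update hj] at hk
  have hA : prodOn (s.erase j) φ a ≠ 0 := by
    rw [← Function.update_eq_self j a, prodOn_update hj] at ha
    exact right_ne_zero_of_mul ha
  intro x y
  refine mul_left_cancel₀ (mul_ne_zero hc0 hA) ?_
  linear_combination ψ j y * hk x - ψ j x * hk y

/-- If a linear combination of products is a product and the complementary factors are linearly
independent, then the factors at `l` which occur are parallel to that of the combination. -/
theorem parallel_of_sum_eq_smul_prodOn {n : Type*} [Fintype n] {s : Finset J} {l : J} (hl : l ∈ s)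
    {α : n → ∀ j, ι j → ℂ} {φ : ∀ j, ι j → ℂ} {c : n → ℂ} {e : ℂ}
    (h : ∑ i, c i • prodOn s (α i) = e • prodOn s φ)
    (hi : ∀ d : n → ℂ, ∑ i, d i • prodOn (s.erase l) (α i) = 0 → ∀ i, d i = 0)
    (i : n) (hc : c i ≠ 0) : Parallel (α i l) (φ l) := by
  intro x y
  -- The slices of the combination at `x` and at `y` are multiples of one function, with factors `φ
  -- l x` and `φ l y`. Eliminating that function leaves a relation between the complementary
  -- products whose coefficients are the minors sought.
  have key := hi (fun i => c i * (α i l x * φ l y - α i l y * φ l x)) (funext fun a => ?_) i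
  · exact sub_eq_zero.1 ((mul_eq_zero.1 key).resolve_left hc)
  · have hk : ∀ z, ∑ i, c i * (α i l z * prodOn (s.erase l) (α i) a)
        = e * (φ l z * prodOn (s.erase l) φ a) := fun z => by
      have := congrFun h (Function.update a l z)
      simpa [Finset.sum_apply, prodOn_update hl] using this
    simp only [Finset.sum_apply, Pi.smul_apply, smul_eq_mul, Pi.zero_apply]
    calc _ = φ l y * ∑ i, c i * (α i l x * prodOn (s.erase l) (α i) a)
          - φ l x * ∑ i, c i * (α i l y * prodOn (s.erase l) (α i) a) := by
          rw [Finset.mul_sum, Finset.mul_sum, ← Finset.sum_sub_distrib]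
          exact Finset.sum_congr rfl fun i _ => by ring
      _ = 0 := by rw [hk, hk]; ring

/-- If a proper linear combination of two products is a product, then the two products have parallel
factors everywhere but at one site. -/
theorem parallel_or_parallel_of_add_eq_smul_prodOn {s : Finset J} {φ ψ χ : ∀ j, ι j → ℂ}
    (hφ : ∀ j, φ j ≠ 0) (hψ : ∀ j, ψ j ≠ 0) {c d e : ℂ} (hc : c ≠ 0) (hd : d ≠ 0)
    (h : c • prodOn s φ + d • prodOn s ψ = e • prodOn s χ) {l m : J} (hl : l ∈ s) (hm : m ∈ s)
    (hlm : l ≠ m) : Parallel (φ l) (ψ l) ∨ Parallel (φ m) (ψ m) := by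
  by_cases h0 : e • prodOn s χ = 0
  · exact Or.inl (parallel_of_smul_prodOn_add_eq_zero hφ hψ (Or.inl hc) (h.trans h0) hl)
  -- Independence of the products off `l` makes both factors at `l` parallel to `χ l`; dependence
  -- makes the factors at `m` parallel.
  by_cases hi : ∀ p q : ℂ, p • prodOn (s.erase l) φ + q • prodOn (s.erase l) ψ = 0 → p = 0 ∧ q = 0
  · left
    have key := parallel_of_sum_eq_smul_prodOn (n := Fin 2) (α := ![φ, ψ]) (c := ![c, d]) hl
      (by simpa using h) (fun e he => by
        have := hi (e 0) (e 1) (by simpa using he)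
        intro i; fin_cases i
        exacts [this.1, this.2])
    exact (key 0 hc).trans (key 1 hd).symm (ne_zero_of_prodOn_ne_zero (right_ne_zero_of_smul h0) hl)
  · right
    push Not at hi
    obtain ⟨p, q, he, hpq⟩ := hi
    exact parallel_of_smul_prodOn_add_eq_zero hφ hψ (by tauto) he
      (Finset.mem_erase.2 ⟨hlm.symm, hm⟩)

end Functions

/-! ### Combinations of three product functions -/

section Three

variable {k : ℕ} {ι : Fin k → Type*}

/-- The factors of the two families are parallel at every site except possibly `l`. -/
def ParallelOff (l : Fin k) (φ ψ : ∀ j, ι j → ℂ) : Prop := ∀ j, j ≠ l → Parallel (φ j) (ψ j)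

theorem ParallelOff.symm {l : Fin k} {φ ψ : ∀ j, ι j → ℂ} (h : ParallelOff l φ ψ) :
    ParallelOff l ψ φ := fun j hj => (h j hj).symm

theorem exists_parallelOff (hk : 0 < k) {φ ψ : ∀ j, ι j → ℂ}
    (h : ∀ l m, l ≠ m → Parallel (φ l) (ψ l) ∨ Parallel (φ m) (ψ m)) : ∃ l, ParallelOff l φ ψ := by
  by_cases h0 : ∃ l, ¬ Parallel (φ l) (ψ l)
  · obtain ⟨l, hl⟩ := h0
    exact ⟨l, fun j hj => (h l j hj.symm).resolve_left hl⟩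
  · push Not at h0
    -- With all sites parallel, any site can serve as the exceptional one.
    exact ⟨⟨0, hk⟩, fun j _ => h0 j⟩

variable {α : Fin 3 → ∀ j, ι j → ℂ}

/-- There are no two pairs among three families that agree off one site each, if at no site all
three families agree. -/
theorem not_parallelOff_of_parallelOff (hk : 3 ≤ k) (h0 : ∀ i j, α i j ≠ 0)
    (hn : ∀ j, ∃ i i', ¬ Parallel (α i j) (α i' j)) {a b c : Fin 3} (hab : a ≠ b) (hac : a ≠ c)
    (hbc : b ≠ c) {l m : Fin k} (h : ParallelOff l (α a) (α b)) (h' : ParallelOff m (α b) (α c)) :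
    False := by
  -- Three sites leave one outside both exceptions, and there all three families agree.
  obtain ⟨j, hj⟩ : ∃ j, j ∉ ({l, m} : Finset (Fin k)) := by
    by_contra! hc
    have h1 : (Finset.univ : Finset (Fin k)).card ≤ ({l, m} : Finset (Fin k)).card :=
      Finset.card_le_card fun x _ => hc x
    have h2 := Finset.card_le_two (a := l) (b := m)
    simp at h1
    omega
  simp only [Finset.mem_insert, Finset.mem_singleton, not_or] at hj
  obtain ⟨i, i', hi⟩ := hn j
  have hp : ∀ i, Parallel (α i j) (α b j) := by
    intro i
    have : i = a ∨ i = b ∨ i = c := by omega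
    rcases this with rfl | rfl | rfl
    · exact h j hj.1
    · exact fun x y => mul_comm _ _
    · exact (h' j hj.2).symm
  exact hi ((hp i).trans (hp i').symm (h0 b j))

/-- Two different pairs out of three indices share a member, which acts as the middle family of
`not_parallelOff_of_parallelOff`. Hence at most one pair agrees off a site. -/
theorem pair_eq_of_parallelOff (hk : 3 ≤ k) (h0 : ∀ i j, α i j ≠ 0)
    (hn : ∀ j, ∃ i i', ¬ Parallel (α i j) (α i' j)) {b c b' c' : Fin 3} (hbc : b ≠ c)
    {l m : Fin k} (h : ParallelOff l (α b) (α c)) (hbc' : b' ≠ c')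
    (h' : ParallelOff m (α b') (α c')) : b' = b ∧ c' = c ∨ b' = c ∧ c' = b := by
  have other := fun {a b c} (hab : a ≠ b) (hac : a ≠ c) (hbc : b ≠ c) {l m} =>
    not_parallelOff_of_parallelOff (l := l) (m := m) hk h0 hn hab hac hbc
  by_cases e1 : b' = b
  · subst e1
    by_cases e2 : c' = c
    · exact Or.inl ⟨rfl, e2⟩
    · exact (other hbc.symm (Ne.symm e2) hbc' h.symm h').elim
  by_cases e2 : b' = c
  · subst e2
    by_cases e3 : c' = b
    · exact Or.inr ⟨rfl, e3⟩
    · exact (other hbc (Ne.symm e3) hbc' h h').elim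
  have e3 : c' = b ∨ c' = c := by omega
  rcases e3 with rfl | rfl
  · exact (other hbc.symm (Ne.symm e2) (Ne.symm e1) h.symm h'.symm).elim
  · exact (other hbc (Ne.symm e1) (Ne.symm e2) h h'.symm).elim

/-- If three products over all sites but `l` are linearly dependent, but do not all agree at any
site, then two of them are parallel. -/
theorem exists_parallelOff_of_dependent (hk : 3 ≤ k) (h0 : ∀ i j, α i j ≠ 0)
    (hn : ∀ j, ∃ i i', ¬ Parallel (α i j) (α i' j)) {l : Fin k} {d : Fin 3 → ℂ}
    (hd : ∑ i, d i • prodOn (Finset.univ.erase l) (α i) = 0) {i : Fin 3} (hi : d i ≠ 0) :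
    ∃ b c, b ≠ c ∧ ParallelOff l (α b) (α c) := by
  obtain ⟨b, c, hib, hic, hbc, hu⟩ : ∃ b c : Fin 3, i ≠ b ∧ i ≠ c ∧ b ≠ c ∧
      (Finset.univ : Finset (Fin 3)) = {i, b, c} := by
    clear hi; revert i; decide
  rw [hu, Finset.sum_insert (by simp [hib, hic]), Finset.sum_pair hbc] at hd
  have pair : ∀ {x y : Fin 3} {p q : ℂ}, x ≠ y → (p ≠ 0 ∨ q ≠ 0) →
      p • prodOn (Finset.univ.erase l) (α x) + q • prodOn (Finset.univ.erase l) (α y) = 0 →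
      ∃ b c, b ≠ c ∧ ParallelOff l (α b) (α c) := fun {x y p q} hxy hp he =>
    ⟨x, y, hxy, fun j hj => parallel_of_smul_prodOn_add_eq_zero (h0 x) (h0 y) hp he
      (Finset.mem_erase.2 ⟨hj, Finset.mem_univ _⟩)⟩
  by_cases hb : d b = 0
  · exact pair hic (Or.inl hi) (by simpa [hb] using hd)
  by_cases hc : d c = 0
  · exact pair hib (Or.inl hi) (by simpa [hc] using hd)
  -- All three coefficients are now nonzero, so each pair combines to a multiple of the third
  -- product and is parallel at `j` or at `m`. Three pairs over two sites: two pairs fall on the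
  -- same site, where all three families then agree.
  exfalso
  obtain ⟨j, hj, m, hm, hjm⟩ : ∃ j ∈ Finset.univ.erase l, ∃ m ∈ Finset.univ.erase l, j ≠ m := by
    refine Finset.one_lt_card.1 ?_
    rw [Finset.card_erase_of_mem (Finset.mem_univ _), Finset.card_univ, Fintype.card_fin]
    omega
  have h1 : Parallel (α i j) (α b j) ∨ Parallel (α i m) (α b m) :=
    parallel_or_parallel_of_add_eq_smul_prodOn (e := -d c) (χ := α c) (h0 i) (h0 b) hi hb
      (by rw [neg_smul, eq_neg_iff_add_eq_zero, ← hd]; abel) hj hm hjm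
  have h2 : Parallel (α i j) (α c j) ∨ Parallel (α i m) (α c m) :=
    parallel_or_parallel_of_add_eq_smul_prodOn (e := -d b) (χ := α b) (h0 i) (h0 c) hi hc
      (by rw [neg_smul, eq_neg_iff_add_eq_zero, ← hd]; abel) hj hm hjm
  have h3 : Parallel (α b j) (α c j) ∨ Parallel (α b m) (α c m) :=
    parallel_or_parallel_of_add_eq_smul_prodOn (e := -d i) (χ := α i) (h0 b) (h0 c) hb hc
      (by rw [neg_smul, eq_neg_iff_add_eq_zero, ← hd]; abel) hj hm hjm
  have all : ∀ j {x y z : Fin 3}, (Finset.univ : Finset (Fin 3)) = {x, y, z} →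
      Parallel (α x j) (α y j) → Parallel (α y j) (α z j) → False := by
    intro j x y z hu hxy hyz
    obtain ⟨p, q, hpq⟩ := hn j
    have hp : ∀ p, Parallel (α p j) (α y j) := by
      intro p
      have : p ∈ ({x, y, z} : Finset (Fin 3)) := hu ▸ Finset.mem_univ p
      simp only [Finset.mem_insert, Finset.mem_singleton] at this
      rcases this with rfl | rfl | rfl
      exacts [hxy, fun _ _ => mul_comm _ _, hyz.symm]
    exact hpq ((hp p).trans (hp q).symm (h0 y j))
  have hu2 : (Finset.univ : Finset (Fin 3)) = {b, i, c} := by rw [hu, Finset.insert_comm]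
  have hu3 : (Finset.univ : Finset (Fin 3)) = {i, c, b} := by rw [hu, Finset.pair_comm]
  rcases h1 with h1 | h1 <;> rcases h2 with h2 | h2 <;> rcases h3 with h3 | h3
  all_goals first
    | exact all _ hu h1 h3
    | exact all _ hu2 h1.symm h2
    | exact all _ hu3 h2 h3.symm

/-- A combination of three product functions with nonzero coefficients is not a product function,
if the three products are pairwise different and do not all agree at any site. -/
theorem sum_smul_prodOn_ne_prodOn (hk : 3 ≤ k) (h0 : ∀ i j, α i j ≠ 0)
    (hn : ∀ j, ∃ i i', ¬ Parallel (α i j) (α i' j))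
    (hd : ∀ b c, b ≠ c → ∃ j, ¬ Parallel (α b j) (α c j)) {d : Fin 3 → ℂ} (hd0 : ∀ i, d i ≠ 0)
    {χ : ∀ j, ι j → ℂ} (hχ : prodOn Finset.univ χ ≠ 0) :
    ∑ i, d i • prodOn Finset.univ (α i) ≠ prodOn Finset.univ χ := by
  intro he
  have key : ∀ l, ∃ b c, b ≠ c ∧ ParallelOff l (α b) (α c) := by
    intro l
    by_cases hi : ∀ e : Fin 3 → ℂ,
        ∑ i, e i • prodOn (Finset.univ.erase l) (α i) = 0 → ∀ i, e i = 0
    · obtain ⟨p, q, hpq⟩ := hn l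
      have := parallel_of_sum_eq_smul_prodOn (e := 1) (Finset.mem_univ l) (by rw [he, one_smul]) hi
      exact absurd ((this p (hd0 p)).trans (this q (hd0 q)).symm
        (ne_zero_of_prodOn_ne_zero hχ (Finset.mem_univ l))) hpq
    · push Not at hi
      obtain ⟨e, he, i, hi⟩ := hi
      exact exists_parallelOff_of_dependent hk h0 hn he hi
  obtain ⟨b, c, hbc, h1⟩ := key ⟨0, by omega⟩
  obtain ⟨b', c', hbc', h2⟩ := key ⟨1, by omega⟩
  -- A pair agreeing off site `0` and off site `1` agrees everywhere.
  have same : ParallelOff ⟨1, by omega⟩ (α b) (α c) → False := by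
    intro h2
    obtain ⟨j, hj⟩ := hd b c hbc
    by_cases hj0 : j = ⟨0, by omega⟩
    · exact hj (h2 j (by rw [hj0]; simp))
    · exact hj (h1 j hj0)
  rcases pair_eq_of_parallelOff hk h0 hn hbc h1 hbc' h2 with ⟨rfl, rfl⟩ | ⟨rfl, rfl⟩
  exacts [same h2, same h2.symm]

end Three

/-! ### Density operators and mixtures of pure states -/

section Operators

variable {E : Type*} [NormedAddCommGroup E] [InnerProductSpace ℂ E]

theorem ketbra_apply (ψ x : E) : ketbra ψ x = inner ℂ ψ x • ψ := rfl

theorem ketbra_smul (c : ℂ) (ψ : E) : ketbra (c • ψ) = ((‖c‖ ^ 2 : ℝ) : ℂ) • ketbra ψ := by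
  ext x
  simp only [ketbra_apply, FunLike.coe_smul, Pi.smul_apply, inner_smul_left, smul_smul]
  congr 1
  push_cast
  rw [← Complex.mul_conj' c]
  ring

theorem ketbra_smul_of_norm_eq_one {c : ℂ} (hc : ‖c‖ = 1) (ψ : E) : ketbra (c • ψ) = ketbra ψ := by
  rw [ketbra_smul, hc]
  simp

theorem ketbra_mem_densityOperators {T : Submodule ℂ E} [FiniteDimensional ℂ T] {ψ : E}
    (h : ψ ∈ T) (h1 : ‖ψ‖ = 1) : ketbra ψ ∈ densityOperators T := by
  refine ⟨InnerProductSpace.isPositive_rankOne_self ψ, fun x => T.smul_mem _ h, ?_⟩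
  have : (((ketbra ψ : E →L[ℂ] E) : E →ₗ[ℂ] E).codRestrict T fun x => T.smul_mem _ h).comp T.subtype
      = ((InnerProductSpace.rankOne ℂ (⟨ψ, h⟩ : T) (⟨ψ, h⟩ : T) : T →L[ℂ] T) : T →ₗ[ℂ] T) := by
    ext x
    rfl
  erw [this]
  rw [InnerProductSpace.trace_rankOne, inner_self_eq_norm_sq_to_K]
  simp [h1]

theorem convex_densityOperators (T : Submodule ℂ E) : Convex ℝ (densityOperators T) := by
  rintro ρ ⟨hρ, h, ht⟩ σ ⟨hσ, h', ht'⟩ a b ha hb hab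
  have hpos : ∀ {a : ℝ} {ρ : E →L[ℂ] E}, 0 ≤ a → ρ.IsPositive → (a • ρ).IsPositive := by
    intro a ρ ha hρ
    have := hρ.smul_of_nonneg (c := (a : ℂ)) (by exact_mod_cast ha)
    rwa [Complex.coe_smul] at this
  have hmem : ∀ x, ((a • ρ + b • σ : E →L[ℂ] E) : E →ₗ[ℂ] E) x ∈ T := fun x =>
    T.add_mem (T.smul_of_tower_mem a (h x)) (T.smul_of_tower_mem b (h' x))
  refine ⟨(hpos ha hρ).add (hpos hb hσ), hmem, ?_⟩
  have : (((a • ρ + b • σ : E →L[ℂ] E) : E →ₗ[ℂ] E).codRestrict T hmem).comp T.subtype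
      = (a : ℂ) • ((ρ : E →ₗ[ℂ] E).codRestrict T h).comp T.subtype
        + (b : ℂ) • ((σ : E →ₗ[ℂ] E).codRestrict T h').comp T.subtype := by
    ext x
    simp
  rw [this, map_add, map_smul, map_smul, ht, ht']
  simp only [smul_eq_mul, mul_one]
  exact_mod_cast hab

/-- The pure states `|ψ⟩⟨ψ|` given by the unit vectors in a set. -/
def pureStates (A : Set E) : Set (E →L[ℂ] E) := {P | ∃ ψ ∈ A, ‖ψ‖ = 1 ∧ P = ketbra ψ}

theorem pureStates_mono {A B : Set E} (h : A ⊆ B) : pureStates A ⊆ pureStates B := by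
  rintro _ ⟨ψ, hψ, h1, rfl⟩
  exact ⟨ψ, h hψ, h1, rfl⟩

theorem pureStates_subset_densityOperators (T : Submodule ℂ E) [FiniteDimensional ℂ T] :
    pureStates (T : Set E) ⊆ densityOperators T := by
  rintro _ ⟨ψ, hψ, h1, rfl⟩
  exact ketbra_mem_densityOperators hψ h1

theorem ketbra_eq_smul_ketbra {ψ : E} (h : ψ ≠ 0) :
    ketbra ψ = (‖ψ‖ ^ 2 : ℝ) • ketbra ((‖ψ‖⁻¹ : ℂ) • ψ) := by
  have h' : ‖ψ‖ ≠ 0 := norm_ne_zero_iff.2 h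
  rw [ketbra_smul, ← Complex.coe_smul, smul_smul]
  have : (((‖ψ‖ ^ 2 : ℝ) : ℂ) * ((‖(‖ψ‖⁻¹ : ℂ)‖ ^ 2 : ℝ) : ℂ)) = 1 := by
    rw [norm_inv, Complex.norm_real, norm_norm]
    norm_cast
    field_simp
  rw [this, one_smul]

theorem norm_inv_norm_smul {ψ : E} (h : ψ ≠ 0) : ‖(‖ψ‖⁻¹ : ℂ) • ψ‖ = 1 := by
  rw [norm_smul, norm_inv, Complex.norm_real, norm_norm, inv_mul_cancel₀ (norm_ne_zero_iff.2 h)]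

/-- Every density operator on a finite-dimensional subspace is a mixture of pure states. -/
theorem densityOperators_eq_convexHull (T : Submodule ℂ E) [FiniteDimensional ℂ T] :
    densityOperators T = convexHull ℝ (pureStates (T : Set E)) := by
  refine Set.Subset.antisymm ?_
    (convexHull_min (pureStates_subset_densityOperators T) (convex_densityOperators T))
  classical
  rintro ρ ⟨hρ, h, ht⟩
  set A : T →ₗ[ℂ] T := ((ρ : E →ₗ[ℂ] E).codRestrict T h).comp T.subtype with hA
  have hApos : (LinearMap.toContinuousLinearMap A).IsPositive :=
    ⟨fun x y => hρ.1 x y, fun x => hρ.2 x⟩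
  obtain ⟨m, u, hu⟩ := ContinuousLinearMap.isPositive_iff_eq_sum_rankOne.1 hApos
  have hAu : A = ∑ i, ((InnerProductSpace.rankOne ℂ (u i) (u i) : T →L[ℂ] T) : T →ₗ[ℂ] T) := by
    ext x
    have := congrArg (fun B : T →L[ℂ] T => ((B x : T) : E)) hu
    simpa using this
  have hsum : ∑ i, ‖u i‖ ^ 2 = 1 := by
    rw [hAu, map_sum] at ht
    simp only [InnerProductSpace.trace_rankOne, inner_self_eq_norm_sq_to_K] at ht
    exact Complex.ofReal_injective (by push_cast; exact ht)
  have hρu : ρ = ∑ i, ketbra (u i : E) := by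
    ext x
    have hx := T.starProjection_add_starProjection_orthogonal x
    -- For `q` in `Tᗮ`, symmetry gives `⟪ρ q, ρ q⟫ = ⟪q, ρ (ρ q)⟫`, which vanishes because the range
    -- of `ρ` lies in `T`.
    have h0 : ρ (Tᗮ.starProjection x) = 0 := by
      refine inner_self_eq_zero (𝕜 := ℂ).1 ?_
      have := hρ.1 (Tᗮ.starProjection x) (ρ (Tᗮ.starProjection x))
      refine this.trans ?_
      rw [← inner_conj_symm, Submodule.inner_right_of_mem_orthogonal (h _) (by simp), map_zero]
    have h1 : ρ (T.starProjection x) = ((A (T.orthogonalProjectionOnto x) : T) : E) := rfl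
    conv_lhs => rw [← hx, map_add, h0, add_zero, h1, hAu]
    simp [ketbra_apply]
  -- Zero vectors cannot be normalised and are dropped; the weights `‖u i‖ ^ 2` sum to the trace,
  -- which is one.
  have hρ' : ρ = ∑ i with u i ≠ 0, ‖u i‖ ^ 2 • ketbra ((‖u i‖⁻¹ : ℂ) • (u i : E)) := by
    rw [hρu, ← Finset.sum_filter_of_ne (p := fun i => u i ≠ 0)]
    · refine Finset.sum_congr rfl fun i hi => ?_
      have : (u i : E) ≠ 0 := by simpa using hi
      exact ketbra_eq_smul_ketbra this
    · intro i _ hne h0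
      refine hne ?_
      rw [h0]
      simp [ketbra]
  rw [hρ']
  refine (convex_convexHull ℝ _).sum_mem (fun _ _ => by positivity) ?_ fun i hi => ?_
  · rw [← hsum, Finset.sum_filter_of_ne]
    intro i _ hne h0
    simp [h0] at hne
  · have : (u i : E) ≠ 0 := by simpa using hi
    exact subset_convexHull ℝ _ ⟨_, T.smul_mem _ (u i).2, norm_inv_norm_smul this, rfl⟩

/-- A mixture of pure states with range in a finite-dimensional subspace is a mixture of pure states
in this subspace. -/
theorem mem_convexHull_pureStates_inter {A : Set E} {T : Submodule ℂ E} [FiniteDimensional ℂ T]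
    {ρ : E →L[ℂ] E} (hρ : ρ ∈ convexHull ℝ (pureStates A)) (hT : ∀ x, ρ x ∈ T) :
    ρ ∈ convexHull ℝ (pureStates (A ∩ T)) := by
  rw [convexHull_eq] at hρ
  obtain ⟨n, t, w, z, hw, hw1, hz, rfl⟩ := hρ
  classical
  -- The range condition says nothing about terms of weight zero, so they are removed.
  rw [← Finset.centerMass_filter_ne_zero]
  refine Finset.centerMass_mem_convexHull _ (fun i hi => hw i (Finset.mem_filter.1 hi).1)
    (by rw [Finset.sum_filter_ne_zero, hw1]; exact one_pos) fun i hi => ?_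
  obtain ⟨hit, hi0⟩ := Finset.mem_filter.1 hi
  obtain ⟨ψ, hψ, h1, hzi⟩ := hz i hit
  refine ⟨ψ, ⟨hψ, ?_⟩, h1, hzi⟩
  -- For `x` in `Tᗮ`, the vanishing number `⟪x, ρ x⟫` is a weighted sum of the terms `‖⟪ψ, x⟫‖ ^ 2`,
  -- so each term of positive weight vanishes.
  rw [← T.orthogonal_orthogonal]
  intro x hx
  have hx0 : inner ℂ x ((t.centerMass w z) x) = 0 :=
    Submodule.inner_left_of_mem_orthogonal (hT x) hx
  rw [Finset.centerMass_eq_of_sum_1 _ _ hw1] at hx0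
  have hterm : ∀ i ∈ t, 0 ≤ RCLike.re (inner ℂ x (z i x)) := by
    intro i hi
    obtain ⟨ψ, -, -, h⟩ := hz i hi
    rw [h]
    exact (InnerProductSpace.isPositive_rankOne_self (𝕜 := ℂ) ψ).re_inner_nonneg_right x
  have hsum : ∑ i ∈ t, w i * RCLike.re (inner ℂ x (z i x)) = 0 := by
    have := congrArg RCLike.re hx0
    simpa [inner_sum, inner_smul_right_eq_smul, Complex.smul_re] using this
  have := (Finset.sum_eq_zero_iff_of_nonneg fun i hi => mul_nonneg (hw i hi) (hterm i hi)).1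
    hsum i hit
  have := (mul_eq_zero.1 this).resolve_left hi0
  rw [hzi, ketbra_apply, inner_smul_right] at this
  rw [← norm_eq_zero, ← sq_eq_zero_iff, ← this, ← inner_conj_symm x ψ, RCLike.mul_conj,
    RCLike.norm_conj]
  norm_cast

/-- The range of `ketbra ψ` lies in the line of `ψ`, so a mixture equal to it uses only vectors of
that line: pure states are extreme. -/
theorem exists_smul_mem_of_ketbra_mem {A : Set E} {ψ : E}
    (h : ketbra ψ ∈ convexHull ℝ (pureStates A)) :
    ∃ χ ∈ A, ‖χ‖ = 1 ∧ ∃ c : ℂ, χ = c • ψ := by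
  have h := mem_convexHull_pureStates_inter (T := Submodule.span ℂ {ψ}) h
    fun x => Submodule.smul_mem _ _ (Submodule.mem_span_singleton_self ψ)
  obtain ⟨_, χ, ⟨hχ, hc⟩, h1, -⟩ := convexHull_nonempty_iff.1 ⟨_, h⟩
  obtain ⟨c, hc⟩ := Submodule.mem_span_singleton.1 hc
  exact ⟨χ, hχ, h1, c, hc.symm⟩

theorem densityOperators_inter_convexHull_pureStates (A : Set E) (T : Submodule ℂ E)
    [FiniteDimensional ℂ T] :
    densityOperators T ∩ convexHull ℝ (pureStates A) = convexHull ℝ (pureStates (A ∩ T)) := by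
  refine Set.Subset.antisymm ?_ (Set.subset_inter ?_ ?_)
  · rintro ρ ⟨⟨_, h, _⟩, hc⟩
    exact mem_convexHull_pureStates_inter hc h
  · rw [densityOperators_eq_convexHull]
    exact convexHull_mono (pureStates_mono Set.inter_subset_right)
  · exact convexHull_mono (pureStates_mono Set.inter_subset_left)

end Operators

/-! ### Multiplicativity of the norm on product vectors -/

section Norm

/-- Fubini, by splitting off the first factor. It is applied to squared moduli. -/
theorem tsum_prod_apply : ∀ {k : ℕ} {ι : Fin k → Type*} (f : ∀ j, ι j → ℝ)
    (_ : ∀ j x, 0 ≤ f j x) (_ : ∀ j, Summable (f j)),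
    ∑' a : (∀ j, ι j), ∏ j, f j (a j) = ∏ j, ∑' x, f j x
  | 0, ι, f, h0, hf => by simp
  | k + 1, ι, f, h0, hf => by
    rw [← (Fin.consEquiv ι).tsum_eq, Fin.prod_univ_succ,
      ← tsum_prod_apply (fun j => f j.succ) (fun j => h0 j.succ) fun j => hf j.succ]
    have hs := summable_prod_apply (fun j : Fin k => f j.succ) (fun j => h0 j.succ)
      fun j => hf j.succ
    rw [tsum_mul_tsum_of_summable_norm (hf 0).norm hs.norm]
    refine tsum_congr fun x => ?_
    rw [Fin.prod_univ_succ]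
    rfl

theorem productVec_apply {J : Type*} [Fintype J] {ι : J → Type*} (φ : ∀ j, Hilb (ι j))
    (a : ∀ j, ι j) :
    (productVec φ : (∀ j, ι j) → ℂ) a = ∏ j, (φ j : ι j → ℂ) (a j) := rfl

theorem norm_sq_eq_tsum {κ : Type*} (u : Hilb κ) : ‖u‖ ^ 2 = ∑' x, ‖(u : κ → ℂ) x‖ ^ 2 := by
  have := lp.norm_rpow_eq_tsum (p := 2) (by norm_num) u
  simpa using this

theorem summable_norm_sq {κ : Type*} (u : Hilb κ) : Summable fun x => ‖(u : κ → ℂ) x‖ ^ 2 := by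
  have := (memℓp_gen_iff (p := 2) (by norm_num)).1 (lp.memℓp u)
  simpa using this

theorem norm_productVec {k : ℕ} {ι : Fin k → Type*} (φ : ∀ j, Hilb (ι j)) :
    ‖productVec φ‖ = ∏ j, ‖φ j‖ := by
  have h : ‖productVec φ‖ ^ 2 = (∏ j, ‖φ j‖) ^ 2 := by
    have hp := tsum_prod_apply (fun j x => ‖(φ j : ι j → ℂ) x‖ ^ 2) (fun j x => sq_nonneg _)
      fun j => summable_norm_sq (φ j)
    rw [norm_sq_eq_tsum, ← Finset.prod_pow, Finset.prod_congr rfl fun j _ => norm_sq_eq_tsum (φ j),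
      ← hp]
    refine tsum_congr fun a => ?_
    rw [productVec_apply, norm_prod, Finset.prod_pow]
  exact (sq_eq_sq₀ (norm_nonneg _) (Finset.prod_nonneg fun _ _ => norm_nonneg _)).1 h

theorem norm_productVec_of_norm_eq_one {k : ℕ} {ι : Fin k → Type*} {φ : ∀ j, Hilb (ι j)}
    (h : ∀ j, ‖φ j‖ = 1) : ‖productVec φ‖ = 1 := by
  simp [norm_productVec, h]

end Norm

/-! ### From coordinate functions to vectors, phases and local spaces -/

section Bridge

theorem ne_zero_of_norm_eq_one {κ : Type*} {u : Hilb κ} (h : ‖u‖ = 1) : (u : κ → ℂ) ≠ 0 := by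
  intro h0
  have : u = 0 := lp.ext h0
  simp [this] at h

theorem exists_smul_of_parallel {κ : Type*} {u v : Hilb κ} (hv : ‖v‖ = 1)
    (h : Parallel (u : κ → ℂ) v) : ∃ c : ℂ, u = c • v := by
  obtain ⟨c, hc⟩ := (parallel_iff_exists_smul (ne_zero_of_norm_eq_one hv)).1 h
  exact ⟨c, lp.ext hc⟩

theorem norm_eq_one_of_smul {E : Type*} [NormedAddCommGroup E] [NormedSpace ℂ E] {u v : E}
    (hu : ‖u‖ = 1) (hv : ‖v‖ = 1) {c : ℂ} (h : u = c • v) : ‖c‖ = 1 := by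
  rw [h, norm_smul, hv, mul_one] at hu
  exact hu

theorem sameState_of_parallel {κ : Type*} {u v : Hilb κ} (hu : ‖u‖ = 1) (hv : ‖v‖ = 1)
    (h : Parallel (u : κ → ℂ) v) : SameState u v := by
  obtain ⟨c, hc⟩ := exists_smul_of_parallel hv h
  exact ⟨c, norm_eq_one_of_smul hu hv hc, hc⟩

theorem linearIndependent_of_not_parallel {κ : Type*} {u : Fin 2 → Hilb κ}
    (h : ¬ Parallel (u 0 : κ → ℂ) (u 1)) : LinearIndependent ℂ u := by
  have hu : u = ![u 0, u 1] := by ext i; fin_cases i <;> rfl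
  rw [hu, LinearIndependent.pair_iff' fun h0 => h fun x y => by simp [h0]]
  intro a ha
  refine h fun x y => ?_
  rw [← ha]
  simp only [lp.coeFn_smul, Pi.smul_apply, smul_eq_mul]
  ring

/-- If all pairs were parallel, the span would be at most a line. The condition on local spans
enters the theorem through this lemma. -/
theorem exists_not_parallel {κ : Type*} {u : Fin 3 → Hilb κ} (h1 : ∀ i, ‖u i‖ = 1)
    (h : Module.finrank ℂ (Submodule.span ℂ (Set.range u)) ∈ ({2, 3} : Set ℕ)) :
    ∃ i i', ¬ Parallel (u i : κ → ℂ) (u i') := by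
  by_contra! hc
  have hle : Submodule.span ℂ (Set.range u) ≤ Submodule.span ℂ {u 0} := by
    rw [Submodule.span_le]
    rintro _ ⟨i, rfl⟩
    obtain ⟨c, hc⟩ := exists_smul_of_parallel (h1 0) (hc i 0)
    exact Submodule.mem_span_singleton.2 ⟨c, hc.symm⟩
  have := (Submodule.finrank_mono hle).trans (finrank_span_le_card _)
  simp only [Set.toFinset_singleton, Finset.card_singleton] at this
  rcases h with h | h
  · omega
  · rw [Set.mem_singleton_iff] at h
    omega

variable {k : ℕ} {ι : Fin k → Type*}

/-- The underlying functions of a family of vectors. -/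
def coeFamily (φ : ∀ j, Hilb (ι j)) : ∀ j, ι j → ℂ := fun j => φ j

theorem prod_update_apply (l : Fin k) (β : ∀ j, Hilb (ι j)) (φ : Hilb (ι l)) (a : ∀ j, ι j) :
    ∏ j, (Function.update β l φ j : ι j → ℂ) (a j)
      = (φ : ι l → ℂ) (a l) * ∏ j ∈ Finset.univ.erase l, (β j : ι j → ℂ) (a j) := by
  rw [← Finset.mul_prod_erase _ _ (Finset.mem_univ l), Function.update_self]
  congr 1
  refine Finset.prod_congr rfl fun j hj => ?_
  rw [Function.update_of_ne (Finset.ne_of_mem_erase hj)]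

/-- `φ ↦ φ ⊗ ⨂_{j ≠ l} β j` as a linear map. -/
def siteMap (l : Fin k) (β : ∀ j, Hilb (ι j)) : Hilb (ι l) →ₗ[ℂ] HilbTensor ι where
  toFun φ := productVec (Function.update β l φ)
  map_add' φ ψ := by
    refine lp.ext (funext fun a => ?_)
    simp only [lp.coeFn_add, Pi.add_apply, productVec_apply]
    rw [prod_update_apply, prod_update_apply, prod_update_apply, lp.coeFn_add, Pi.add_apply,
      add_mul]
  map_smul' c φ := by
    refine lp.ext (funext fun a => ?_)
    simp only [lp.coeFn_smul, Pi.smul_apply, productVec_apply, RingHom.id_apply, smul_eq_mul]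
    rw [prod_update_apply, prod_update_apply, lp.coeFn_smul, Pi.smul_apply, smul_eq_mul, mul_assoc]

theorem siteMap_apply (l : Fin k) (β : ∀ j, Hilb (ι j)) (φ : Hilb (ι l)) :
    siteMap l β φ = productVec (Function.update β l φ) := rfl

theorem siteMap_self (l : Fin k) (β : ∀ j, Hilb (ι j)) : siteMap l β (β l) = productVec β := by
  rw [siteMap_apply, Function.update_eq_self]

/-- The generating set is already a subspace, so every element of a local space, not just a
generator, is a product vector. -/
theorem localSpace_eq_map (l : Fin k) (W : Submodule ℂ (Hilb (ι l))) (β : ∀ j, Hilb (ι j)) :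
    localSpace l W β = W.map (siteMap l β) := by
  have : {ψ | ∃ φ ∈ W, ψ = productVec (Function.update β l φ)}
      = (W.map (siteMap l β) : Set (HilbTensor ι)) := by
    ext ψ
    simp only [Set.mem_ofPred_eq, Submodule.map_coe, Set.mem_image, SetLike.mem_coe, siteMap_apply]
    exact exists_congr fun φ => and_congr_right fun _ => eq_comm
  rw [localSpace, this, Submodule.span_eq]

theorem isProductVector_of_mem_localSpace {l : Fin k} {W : Submodule ℂ (Hilb (ι l))}
    {β : ∀ j, Hilb (ι j)} {ψ : HilbTensor ι} (h : ψ ∈ localSpace l W β) : IsProductVector ψ := by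
  rw [localSpace_eq_map] at h
  obtain ⟨φ, -, rfl⟩ := h
  exact ⟨_, rfl⟩

theorem productVec_smul (c : Fin k → ℂ) (φ : ∀ j, Hilb (ι j)) :
    productVec (fun j => c j • φ j) = (∏ j, c j) • productVec φ := by
  refine lp.ext (funext fun a => ?_)
  simp [productVec_apply, Finset.prod_mul_distrib]

/-- The scalar is absorbed at site `0`. With no sites, the empty product would be the only product
vector. -/
theorem IsProductVector.smul (hk : 0 < k) {ψ : HilbTensor ι} (h : IsProductVector ψ) (c : ℂ) :
    IsProductVector (c • ψ) := by
  obtain ⟨φ, rfl⟩ := h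
  refine ⟨Function.update φ ⟨0, hk⟩ (c • φ ⟨0, hk⟩), ?_⟩
  rw [← siteMap_apply, map_smul, siteMap_self]

theorem IsProductVector.exists_norm_eq_one {ψ : HilbTensor ι} (h : IsProductVector ψ) (h0 : ψ ≠ 0) :
    ∃ φ : ∀ j, Hilb (ι j), (∀ j, ‖φ j‖ = 1) ∧ ∃ c : ℂ, c ≠ 0 ∧ ψ = c • productVec φ := by
  obtain ⟨φ, rfl⟩ := h
  have hφ : ∏ j, ‖φ j‖ ≠ 0 := by rwa [← norm_productVec, norm_ne_zero_iff]
  have hj : ∀ j, ‖φ j‖ ≠ 0 := fun j => Finset.prod_ne_zero_iff.1 hφ j (Finset.mem_univ j)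
  refine ⟨fun j => (‖φ j‖⁻¹ : ℂ) • φ j, fun j => norm_inv_norm_smul (norm_ne_zero_iff.1 (hj j)),
    ∏ j, (‖φ j‖ : ℂ), by exact_mod_cast hφ, ?_⟩
  rw [productVec_smul, smul_smul, ← Finset.prod_mul_distrib, Finset.prod_eq_one, one_smul]
  intro j _
  exact mul_inv_cancel₀ (by exact_mod_cast hj j)

/-- Unit families that agree off `l` up to phases have product vectors in a common local space. -/
theorem exists_productVec_eq_smul_siteMap {l : Fin k} {φ ψ : ∀ j, Hilb (ι j)}
    (hφ : ∀ j, ‖φ j‖ = 1) (hψ : ∀ j, ‖ψ j‖ = 1) (h : ParallelOff l (coeFamily φ) (coeFamily ψ)) :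
    ∃ c : ℂ, ‖c‖ = 1 ∧ productVec ψ = c • siteMap l φ (ψ l) := by
  have hc : ∀ j, ∃ c : ℂ, ‖c‖ = 1 ∧ ψ j = c • (Function.update φ l (ψ l)) j := by
    intro j
    by_cases hj : j = l
    · subst hj
      exact ⟨1, norm_one, by simp⟩
    · rw [Function.update_of_ne hj]
      exact sameState_of_parallel (hψ j) (hφ j) (h.symm j hj)
  choose c hc1 hc using hc
  refine ⟨∏ j, c j, by rw [norm_prod]; exact Finset.prod_eq_one fun j _ => hc1 j, ?_⟩
  rw [siteMap_apply, ← productVec_smul]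
  exact congrArg productVec (funext hc)

theorem span_pair_eq_localSpace {l : Fin k} {φ ψ : ∀ j, Hilb (ι j)}
    (hφ : ∀ j, ‖φ j‖ = 1) (hψ : ∀ j, ‖ψ j‖ = 1) (h : ParallelOff l (coeFamily φ) (coeFamily ψ)) :
    Submodule.span ℂ {productVec φ, productVec ψ}
      = localSpace l (Submodule.span ℂ {φ l, ψ l}) φ := by
  obtain ⟨c, hc, he⟩ := exists_productVec_eq_smul_siteMap hφ hψ h
  have hc0 : c ≠ 0 := by rintro rfl; simp at hc
  rw [localSpace_eq_map, Submodule.map_span, Set.image_pair, siteMap_self, he,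
    Submodule.span_insert, Submodule.span_insert,
    Submodule.span_singleton_smul_eq (IsUnit.mk0 c hc0)]

theorem exists_productVec_eq_smul {φ ψ : ∀ j, Hilb (ι j)} (hψ : ∀ j, ‖ψ j‖ = 1)
    (h : ∀ j, Parallel (coeFamily φ j) (coeFamily ψ j)) :
    ∃ c : ℂ, productVec φ = c • productVec ψ := by
  choose c hc using fun j => exists_smul_of_parallel (hψ j) (h j)
  refine ⟨∏ j, c j, ?_⟩
  rw [← productVec_smul]
  exact congrArg productVec (funext hc)

theorem sameState_productVecOff {l : Fin k} {φ ψ : ∀ j, Hilb (ι j)}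
    (hφ : ∀ j, ‖φ j‖ = 1) (hψ : ∀ j, ‖ψ j‖ = 1) (h : ParallelOff l (coeFamily φ) (coeFamily ψ)) :
    SameState (productVecOff l φ) (productVecOff l ψ) := by
  have hc : ∀ j : {j // j ≠ l}, SameState (φ j) (ψ j) := fun j =>
    sameState_of_parallel (hφ j) (hψ j) (h j j.2)
  choose c hc1 hc using hc
  refine ⟨∏ j, c j, by rw [norm_prod]; exact Finset.prod_eq_one fun j _ => hc1 j, ?_⟩
  refine lp.ext (funext fun a => ?_)
  simp only [productVecOff, productVec_apply, lp.coeFn_smul, Pi.smul_apply, smul_eq_mul, hc]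
  rw [Finset.prod_mul_distrib]

theorem separableStates_eq_convexHull (S : Submodule ℂ (HilbTensor ι)) [FiniteDimensional ℂ S] :
    separableStates S = convexHull ℝ (pureStates ({ψ | IsProductVector ψ} ∩ S)) :=
  densityOperators_inter_convexHull_pureStates _ S

theorem sepSpan_le (S : Submodule ℂ (HilbTensor ι)) : sepSpan S ≤ S :=
  Submodule.span_le.2 fun _ h => h.1

/-- The span of the product vectors in `S` has a basis of product states. -/
theorem exists_unit_family {n : ℕ} {S : Submodule ℂ (HilbTensor ι)} [FiniteDimensional ℂ S]
    (h : Module.finrank ℂ (sepSpan S) = n) :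
    ∃ α : Fin n → ∀ j, Hilb (ι j), (∀ i j, ‖α i j‖ = 1) ∧ (∀ i, productVec (α i) ∈ S) ∧
      sepSpan S = Submodule.span ℂ (Set.range fun i => productVec (α i)) := by
  unfold sepSpan at h ⊢
  subst h
  have : FiniteDimensional ℂ (Submodule.span ℂ {ψ | ψ ∈ S ∧ IsProductVector ψ}) :=
    Submodule.finiteDimensional_of_le (sepSpan_le S)
  obtain ⟨f, hf, hs, hl⟩ := Submodule.exists_fun_fin_finrank_span_eq ℂ
    {ψ | ψ ∈ S ∧ IsProductVector ψ}
  choose α h1 c hc he using fun i => (hf i).2.exists_norm_eq_one (hl.ne_zero i)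
  have hα : ∀ i, productVec (α i) = (c i)⁻¹ • f i := fun i => by rw [he, inv_smul_smul₀ (hc i)]
  refine ⟨α, h1, fun i => hα i ▸ S.smul_mem _ (hf i).1, ?_⟩
  refine le_antisymm ?_ ?_
  · refine hs.symm.le.trans (Submodule.span_le.2 ?_)
    rintro _ ⟨i, rfl⟩
    rw [he]
    exact Submodule.smul_mem _ _ (Submodule.subset_span ⟨i, rfl⟩)
  · rw [Submodule.span_le]
    rintro _ ⟨i, rfl⟩
    change productVec (α i) ∈ Submodule.span ℂ _
    rw [hα]
    exact Submodule.smul_mem _ _ (Submodule.subset_span (hf i))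

theorem mem_sepSpan {S : Submodule ℂ (HilbTensor ι)} {ψ : HilbTensor ι} (h : ψ ∈ S)
    (hp : IsProductVector ψ) : ψ ∈ sepSpan S := Submodule.subset_span ⟨h, hp⟩

end Bridge

/-! ### Product vectors in spans, and exclusion of the bipartite shapes -/

section Classification

variable {k : ℕ} {ι : Fin k → Type*}

/-- The product vectors in the span of two product states that differ in at least two subsystems. -/
theorem exists_eq_smul_of_mem_span_pair {φ ψ : ∀ j, Hilb (ι j)} (hφ : ∀ j, ‖φ j‖ = 1)
    (hψ : ∀ j, ‖ψ j‖ = 1) {l m : Fin k} (hlm : l ≠ m) (hl : ¬ Parallel (φ l : ι l → ℂ) (ψ l))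
    (hm : ¬ Parallel (φ m : ι m → ℂ) (ψ m)) {χ : HilbTensor ι} (hχ : IsProductVector χ)
    (h : χ ∈ Submodule.span ℂ {productVec φ, productVec ψ}) :
    (∃ z : ℂ, χ = z • productVec φ) ∨ ∃ z : ℂ, χ = z • productVec ψ := by
  obtain ⟨c, d, rfl⟩ := Submodule.mem_span_pair.1 h
  by_cases hc : c = 0
  · exact Or.inr ⟨d, by simp [hc]⟩
  by_cases hd : d = 0
  · exact Or.inl ⟨c, by simp [hd]⟩
  exfalso
  obtain ⟨η, hη⟩ := hχ
  have he : c • prodOn Finset.univ (coeFamily φ) + d • prodOn Finset.univ (coeFamily ψ)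
      = (1 : ℂ) • prodOn Finset.univ (coeFamily η) := by
    rw [one_smul]
    exact congrArg (fun u : HilbTensor ι => (u : (∀ j, ι j) → ℂ)) hη
  exact (parallel_or_parallel_of_add_eq_smul_prodOn (fun j => ne_zero_of_norm_eq_one (hφ j))
    (fun j => ne_zero_of_norm_eq_one (hψ j)) hc hd he (Finset.mem_univ l) (Finset.mem_univ m)
    hlm).elim hl hm

theorem exists_eq_smul_or_parallelOff_of_mem_span_pair (hk : 0 < k) {φ ψ : ∀ j, Hilb (ι j)}
    (hφ : ∀ j, ‖φ j‖ = 1) (hψ : ∀ j, ‖ψ j‖ = 1) {χ : HilbTensor ι} (hχ : IsProductVector χ)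
    (h : χ ∈ Submodule.span ℂ {productVec φ, productVec ψ}) :
    (∃ z : ℂ, χ = z • productVec φ) ∨ (∃ z : ℂ, χ = z • productVec ψ) ∨
      ∃ l, ParallelOff l (coeFamily φ) (coeFamily ψ) := by
  by_cases hc : ∃ l m, l ≠ m ∧ ¬ Parallel (φ l : ι l → ℂ) (ψ l) ∧ ¬ Parallel (φ m : ι m → ℂ) (ψ m)
  · obtain ⟨l, m, hlm, hl, hm⟩ := hc
    rcases exists_eq_smul_of_mem_span_pair hφ hψ hlm hl hm hχ h with h | h
    exacts [Or.inl h, Or.inr (Or.inl h)]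
  · refine Or.inr (Or.inr (exists_parallelOff hk fun l m hlm => ?_))
    by_contra! hn
    exact hc ⟨l, m, hlm, hn⟩

theorem exists_not_parallel_of_linearIndependent {n : Type*} {α : n → ∀ j, Hilb (ι j)}
    (h1 : ∀ i j, ‖α i j‖ = 1) (hl : LinearIndependent ℂ fun i => productVec (α i)) {b c : n}
    (hbc : b ≠ c) : ∃ j, ¬ Parallel (α b j : ι j → ℂ) (α c j) := by
  by_contra! hp
  obtain ⟨z, hz⟩ := exists_productVec_eq_smul (h1 c) hp
  refine hl.notMem_span_image (s := {c}) (x := b) (by simpa using hbc) ?_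
  rw [Set.image_singleton]
  exact Submodule.mem_span_singleton.2 ⟨z, hz.symm⟩

/-- The product vectors in the span of three independent product states. -/
theorem exists_eq_smul_or_mem_span_pair (hk : 3 ≤ k) {α : Fin 3 → ∀ j, Hilb (ι j)}
    (h1 : ∀ i j, ‖α i j‖ = 1) (hl : LinearIndependent ℂ fun i => productVec (α i))
    (hn : ∀ j, ∃ i i', ¬ Parallel (α i j : ι j → ℂ) (α i' j)) {χ : HilbTensor ι}
    (hχ : IsProductVector χ)
    (h : χ ∈ Submodule.span ℂ (Set.range fun i => productVec (α i))) :
    (∃ i, ∃ z : ℂ, χ = z • productVec (α i)) ∨ ∃ l b c, b ≠ c ∧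
      ParallelOff l (coeFamily (α b)) (coeFamily (α c)) ∧
      χ ∈ Submodule.span ℂ {productVec (α b), productVec (α c)} := by
  by_cases h0 : χ = 0
  · exact Or.inl ⟨0, 0, by rw [h0, zero_smul]⟩
  obtain ⟨d, hd⟩ := (Submodule.mem_span_range_iff_exists_fun ℂ).1 h
  by_cases hall : ∀ i, d i ≠ 0
  · exfalso
    obtain ⟨η, hη⟩ := hχ
    refine sum_smul_prodOn_ne_prodOn (α := fun i => coeFamily (α i)) (χ := coeFamily η) hk
      (fun i j => ne_zero_of_norm_eq_one (h1 i j)) hn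
      (fun b c hbc => exists_not_parallel_of_linearIndependent h1 hl hbc) hall ?_ ?_
    · intro hz
      exact h0 (hη.trans (lp.ext hz))
    · rw [Fin.sum_univ_three] at hd ⊢
      exact congrArg (fun u : HilbTensor ι => (u : (∀ j, ι j) → ℂ)) (hd.trans hη)
  · push Not at hall
    obtain ⟨a, ha⟩ := hall
    obtain ⟨b, c, hab, hac, hbc, hu⟩ : ∃ b c : Fin 3, a ≠ b ∧ a ≠ c ∧ b ≠ c ∧
        (Finset.univ : Finset (Fin 3)) = {a, b, c} := by
      clear ha; revert a; decide
    rw [hu, Finset.sum_insert (by simp [hab, hac]), Finset.sum_pair hbc, ha, zero_smul,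
      zero_add] at hd
    have hmem : χ ∈ Submodule.span ℂ {productVec (α b), productVec (α c)} :=
      Submodule.mem_span_pair.2 ⟨_, _, hd⟩
    rcases exists_eq_smul_or_parallelOff_of_mem_span_pair (by omega) (h1 b) (h1 c) hχ hmem with
      h | h | ⟨l, h⟩
    · exact Or.inl ⟨b, h⟩
    · exact Or.inl ⟨c, h⟩
    · exact Or.inr ⟨l, b, c, hbc, h, hmem⟩

/-- Either all product vectors in the span of three product states are multiples of these, or the
product vectors form the union of a line and a local qubit space. -/
theorem product_lines_or_local_qubit (hk : 3 ≤ k) {α : Fin 3 → ∀ j, Hilb (ι j)}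
    (h1 : ∀ i j, ‖α i j‖ = 1) (hl : LinearIndependent ℂ fun i => productVec (α i))
    (hn : ∀ j, ∃ i i', ¬ Parallel (α i j : ι j → ℂ) (α i' j)) :
    (∀ χ ∈ Submodule.span ℂ (Set.range fun i => productVec (α i)), IsProductVector χ →
      ∃ i, ∃ z : ℂ, χ = z • productVec (α i)) ∨
    ∃ l, ∃ a b c : Fin 3, a ≠ b ∧ a ≠ c ∧ b ≠ c ∧
      ParallelOff l (coeFamily (α b)) (coeFamily (α c)) ∧
      ∀ χ ∈ Submodule.span ℂ (Set.range fun i => productVec (α i)), IsProductVector χ →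
        (∃ z : ℂ, χ = z • productVec (α a)) ∨
        χ ∈ Submodule.span ℂ {productVec (α b), productVec (α c)} := by
  by_cases hex : ∃ l, ∃ b c : Fin 3, b ≠ c ∧ ParallelOff l (coeFamily (α b)) (coeFamily (α c))
  · right
    obtain ⟨l, b, c, hbc, hp⟩ := hex
    obtain ⟨a, hab, hac, hu⟩ : ∃ a : Fin 3, a ≠ b ∧ a ≠ c ∧ ∀ i, i = a ∨ i = b ∨ i = c := by
      clear hp; revert b c; decide
    refine ⟨l, a, b, c, hab, hac, hbc, hp, fun χ hχ hχp => ?_⟩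
    rcases exists_eq_smul_or_mem_span_pair hk h1 hl hn hχp hχ with
      ⟨i, z, hz⟩ | ⟨m, b', c', hbc', hp', hm⟩
    · rcases hu i with rfl | rfl | rfl
      · exact Or.inl ⟨z, hz⟩
      · exact Or.inr (hz ▸ Submodule.smul_mem _ _ (Submodule.subset_span (by simp)))
      · exact Or.inr (hz ▸ Submodule.smul_mem _ _ (Submodule.subset_span (by simp)))
    · right
      -- Uniqueness of the agreeing pair shows that there is only one local qubit.
      rcases pair_eq_of_parallelOff (α := fun i => coeFamily (α i)) hk
        (fun i j => ne_zero_of_norm_eq_one (h1 i j)) hn hbc hp hbc' hp' with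
        ⟨rfl, rfl⟩ | ⟨rfl, rfl⟩
      · exact hm
      · rwa [Set.pair_comm] at hm
  · left
    intro χ hχ hχp
    rcases exists_eq_smul_or_mem_span_pair hk h1 hl hn hχp hχ with
      h | ⟨m, b', c', hbc', hp', hm⟩
    · exact h
    · exact (hex ⟨m, b', c', hbc', hp'⟩).elim

theorem ketbra_eq_of_eq_smul {E : Type*} [NormedAddCommGroup E] [InnerProductSpace ℂ E] {u v : E}
    (hu : ‖u‖ = 1) (hv : ‖v‖ = 1) {z : ℂ} (h : u = z • v) : ketbra u = ketbra v := by
  rw [h, ketbra_smul_of_norm_eq_one (norm_eq_one_of_smul hu hv h)]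

/-- If all product vectors in `S` are multiples of some product states in `S`, then the separable
states over `S` are the mixtures of these. -/
theorem separableStates_eq_convexHull_range {n : Type*} {S : Submodule ℂ (HilbTensor ι)}
    [FiniteDimensional ℂ S] {α : n → ∀ j, Hilb (ι j)} (h1 : ∀ i j, ‖α i j‖ = 1)
    (hS : ∀ i, productVec (α i) ∈ S)
    (h : ∀ χ ∈ S, IsProductVector χ → ∃ i, ∃ z : ℂ, χ = z • productVec (α i)) :
    separableStates S = convexHull ℝ (Set.range fun i => ketbra (productVec (α i))) := by
  rw [separableStates_eq_convexHull]
  congr 1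
  ext P
  constructor
  · rintro ⟨χ, ⟨hp, hχ⟩, hχ1, rfl⟩
    obtain ⟨i, z, hz⟩ := h χ hχ hp
    exact ⟨i, (ketbra_eq_of_eq_smul hχ1 (norm_productVec_of_norm_eq_one (h1 i)) hz).symm⟩
  · rintro ⟨i, rfl⟩
    exact ⟨_, ⟨⟨_, rfl⟩, hS i⟩, norm_productVec_of_norm_eq_one (h1 i), rfl⟩

/-- A pure separable state over `S` is a product state in `S`. -/
theorem isProductVector_of_ketbra_mem (hk : 0 < k) {S : Submodule ℂ (HilbTensor ι)}
    [FiniteDimensional ℂ S] {ψ : HilbTensor ι} (h : ketbra ψ ∈ separableStates S) :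
    IsProductVector ψ ∧ ψ ∈ S := by
  rw [separableStates_eq_convexHull] at h
  obtain ⟨χ, ⟨hp, hχ⟩, h1, c, rfl⟩ := exists_smul_mem_of_ketbra_mem h
  have hc : c ≠ 0 := by rintro rfl; simp at h1
  rw [← inv_smul_smul₀ hc ψ]
  exact ⟨IsProductVector.smul hk hp _, S.smul_mem _ hχ⟩

theorem isProductVector_of_ketbra_normalize_mem (hk : 0 < k) {S : Submodule ℂ (HilbTensor ι)}
    [FiniteDimensional ℂ S] {ψ : HilbTensor ι} (h0 : ψ ≠ 0)
    (h : ketbra ((‖ψ‖⁻¹ : ℂ) • ψ) ∈ separableStates S) : IsProductVector ψ ∧ ψ ∈ S := by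
  obtain ⟨hp, hS⟩ := isProductVector_of_ketbra_mem hk h
  have hc : (‖ψ‖⁻¹ : ℂ) ≠ 0 := inv_ne_zero (by exact_mod_cast norm_ne_zero_iff.2 h0)
  rw [← inv_smul_smul₀ hc ψ]
  exact ⟨IsProductVector.smul hk hp _, S.smul_mem _ hS⟩

variable {S W : Submodule ℂ (HilbTensor ι)} {Φ : HilbTensor ι}

/-- The separable states are not the hull of two sets of all states of qubit spaces, if the product
vectors are contained in a line and a subspace not containing this line. -/
theorem not_isTwoQubitHull (hk : 0 < k) [FiniteDimensional ℂ S] [FiniteDimensional ℂ W]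
    (hΦ : ketbra Φ ∈ separableStates S) (hΦW : Φ ∉ W)
    (h : ∀ χ ∈ S, IsProductVector χ → (∃ z : ℂ, χ = z • Φ) ∨ χ ∈ W) :
    ¬ IsTwoQubitHull (separableStates S) := by
  rintro ⟨S₁, S₂, h₁, h₂, hD⟩
  have hle : ∀ T : Submodule ℂ (HilbTensor ι), Module.finrank ℂ T = 2 →
      densityOperators T ⊆ separableStates S → T ≤ W := by
    intro T hT hTD
    have : FiniteDimensional ℂ T := Module.finite_of_finrank_pos (by omega)
    have hcov : ∀ x ∈ T, (∃ z : ℂ, x = z • Φ) ∨ x ∈ W := by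
      intro x hx
      by_cases h0 : x = 0
      · exact Or.inl ⟨0, by simp [h0]⟩
      obtain ⟨hp, hS⟩ := isProductVector_of_ketbra_normalize_mem hk h0
        (hTD (ketbra_mem_densityOperators (T.smul_mem _ hx) (norm_inv_norm_smul h0)))
      exact h x hS hp
    by_contra hn
    obtain ⟨x, hx, hxW⟩ := SetLike.not_le_iff_exists.1 hn
    obtain ⟨z, hz⟩ := (hcov x hx).resolve_right hxW
    -- `T` is covered by the line of `Φ` and `W`. For `y` in `W`, the sum `x + y` stays outside `W`,
    -- so both `x` and `x + y` lie on the line, and so does `y`.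
    have hline : T ≤ Submodule.span ℂ {Φ} := by
      intro y hy
      rcases hcov y hy with ⟨z', hz'⟩ | hyW
      · exact Submodule.mem_span_singleton.2 ⟨z', hz'.symm⟩
      · obtain ⟨z', hz'⟩ := (hcov (x + y) (T.add_mem hx hy)).resolve_right
          fun hxy => hxW (by simpa using W.sub_mem hxy hyW)
        refine Submodule.mem_span_singleton.2 ⟨z' - z, ?_⟩
        rw [sub_smul, ← hz', ← hz, add_sub_cancel_left]
    have := (Submodule.finrank_mono hline).trans (finrank_span_le_card _)
    simp only [Set.toFinset_singleton, Finset.card_singleton] at this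
    omega
  have hsub : ∀ T : Submodule ℂ (HilbTensor ι), Module.finrank ℂ T = 2 → T ≤ W →
      densityOperators T ⊆ densityOperators W := by
    intro T hT hTW
    have : FiniteDimensional ℂ T := Module.finite_of_finrank_pos (by omega)
    rw [densityOperators_eq_convexHull, densityOperators_eq_convexHull]
    exact convexHull_mono (pureStates_mono hTW)
  have hD' : separableStates S ⊆ densityOperators W := by
    rw [hD]
    refine convexHull_min (Set.union_subset ?_ ?_) (convex_densityOperators W)
    · exact hsub S₁ h₁ (hle S₁ h₁ (hD ▸ Set.subset_union_left.trans (subset_convexHull ℝ _)))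
    · exact hsub S₂ h₂ (hle S₂ h₂ (hD ▸ Set.subset_union_right.trans (subset_convexHull ℝ _)))
  -- The pure state of `Φ` would now be a state over `W`, which forces `Φ ∈ W`.
  have hΦ' := hD' hΦ
  rw [densityOperators_eq_convexHull] at hΦ'
  obtain ⟨χ, hχ, hχ1, c, rfl⟩ := exists_smul_mem_of_ketbra_mem hΦ'
  have hc : c ≠ 0 := by rintro rfl; simp at hχ1
  exact hΦW ((W.smul_mem_iff hc).1 hχ)

theorem cutProductVec_apply {J : Type*} {ι : J → Type*} [Fintype J] (p : J → Prop)
    (u : HilbTensor fun j : {j // p j} => ι j) (v : HilbTensor fun j : {j // ¬ p j} => ι j)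
    (a : ∀ j, ι j) :
    (cutProductVec p u v : (∀ j, ι j) → ℂ) a = (u : (∀ j : {j // p j}, ι j) → ℂ) (fun j => a j) *
      (v : (∀ j : {j // ¬ p j}, ι j) → ℂ) (fun j => a j) := rfl

/-- If `u ⊗ v` is nonzero and a multiple of `u' ⊗ v'`, then `u` is a multiple of `u'`. -/
theorem exists_eq_smul_of_cutProductVec_eq_smul {p : Fin k → Prop}
    {u u' : HilbTensor fun j : {j // p j} => ι j} {v v' : HilbTensor fun j : {j // ¬ p j} => ι j}
    (h0 : cutProductVec p u v ≠ 0) {z : ℂ} (h : cutProductVec p u v = z • cutProductVec p u' v') :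
    ∃ c : ℂ, u = c • u' := by
  classical
  have hne : (cutProductVec p u v : (∀ j, ι j) → ℂ) ≠ 0 := fun hz => h0 (lp.ext hz)
  obtain ⟨a, ha⟩ := Function.ne_iff.1 hne
  -- Freezing the second argument at a point where `v` does not vanish turns the identity into one
  -- between `u` and `u'`.
  set y : ∀ j : {j // ¬ p j}, ι j := fun j => a j with hy
  have hv : (v : (∀ j : {j // ¬ p j}, ι j) → ℂ) y ≠ 0 := by
    rw [cutProductVec_apply] at ha
    exact right_ne_zero_of_mul ha
  refine ⟨z * (v' : (∀ j : {j // ¬ p j}, ι j) → ℂ) y / (v : (∀ j : {j // ¬ p j}, ι j) → ℂ) y,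
    lp.ext (funext fun x => ?_)⟩
  have hx := congrArg (fun w : HilbTensor ι =>
    (w : (∀ j, ι j) → ℂ) ((Equiv.piEquivPiSubtypeProd p ι).symm (x, y))) h
  have e1 : (fun j : {j // p j} => (Equiv.piEquivPiSubtypeProd p ι).symm (x, y) j) = x :=
    congrArg Prod.fst ((Equiv.piEquivPiSubtypeProd p ι).apply_symm_apply (x, y))
  have e2 : (fun j : {j // ¬ p j} => (Equiv.piEquivPiSubtypeProd p ι).symm (x, y) j) = y :=
    congrArg Prod.snd ((Equiv.piEquivPiSubtypeProd p ι).apply_symm_apply (x, y))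
  simp only [lp.coeFn_smul, Pi.smul_apply, smul_eq_mul, cutProductVec_apply] at hx
  rw [e1, e2] at hx
  simp only [lp.coeFn_smul, Pi.smul_apply, smul_eq_mul]
  field_simp
  linear_combination hx

/-- The separable states are not the hull of the states `ψ ⊗ L ψ`, if the product vectors are
contained in a line and a subspace not containing this line. -/
theorem not_isSymmetricHull (hk : 0 < k) [FiniteDimensional ℂ S]
    (hΦ : ketbra Φ ∈ separableStates S) (hΦW : Φ ∉ W)
    (h : ∀ χ ∈ S, IsProductVector χ → (∃ z : ℂ, χ = z • Φ) ∨ χ ∈ W) :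
    ¬ IsSymmetricHull (separableStates S) := by
  rintro ⟨p, V, L, hV, -, hD⟩
  set X : V → HilbTensor ι := fun ψ =>
    cutProductVec p (ψ : HilbTensor fun j : {j // p j} => ι j) (L ψ) with hX
  have hsub : {P | ∃ (ψ : V) (γ : ℂ) (Ψ : HilbTensor ι), Ψ = γ • X ψ ∧ ‖Ψ‖ = 1 ∧ P = ketbra Ψ}
      = pureStates {Ψ | ∃ (ψ : V) (γ : ℂ), Ψ = γ • X ψ} := by
    ext P
    constructor
    · rintro ⟨ψ, γ, Ψ, h, h1, hP⟩
      exact ⟨Ψ, ⟨ψ, γ, h⟩, h1, hP⟩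
    · rintro ⟨Ψ, ⟨ψ, γ, h⟩, h1, hP⟩
      exact ⟨ψ, γ, Ψ, h, h1, hP⟩
  have hD' : separableStates S
      = convexHull ℝ (pureStates {Ψ | ∃ (ψ : V) (γ : ℂ), Ψ = γ • X ψ}) := by
    rw [← hsub]; exact hD
  have hcov : ∀ ψ, (∃ z : ℂ, X ψ = z • Φ) ∨ X ψ ∈ W := by
    intro ψ
    by_cases h0 : X ψ = 0
    · exact Or.inl ⟨0, by rw [h0, zero_smul]⟩
    obtain ⟨hp, hS⟩ := isProductVector_of_ketbra_normalize_mem hk h0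
      (by rw [hD']; exact subset_convexHull ℝ _ ⟨_, ⟨ψ, _, rfl⟩, norm_inv_norm_smul h0, rfl⟩)
    exact h _ hS hp
  -- By extremality `Φ` is itself a multiple of some `X e`.
  obtain ⟨_, ⟨e, γ, rfl⟩, h1, c, hc⟩ := exists_smul_mem_of_ketbra_mem (hD' ▸ hΦ)
  have hγ : γ ≠ 0 := by rintro rfl; simp at h1
  have hc0 : c ≠ 0 := by rintro rfl; rw [hc] at h1; simp at h1
  have hΦX : Φ = (c⁻¹ * γ) • X e := by rw [mul_smul, hc, inv_smul_smul₀ hc0]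
  obtain ⟨f, hf⟩ : ∃ f : V, f ∉ Submodule.span ℂ {e} := by
    by_contra! hall
    have := finrank_le_one e fun w => Submodule.mem_span_singleton.1 (hall w)
    omega
  -- `f + t • e` is never a multiple of `e`, so comparing first tensor factors keeps a nonzero `X (f
  -- + t • e)` off the line of `Φ`.
  have hW : ∀ t : ℂ, X (f + t • e) ∈ W := by
    intro t
    by_cases h0 : X (f + t • e) = 0
    · rw [h0]; exact W.zero_mem
    refine (hcov _).resolve_left ?_
    rintro ⟨z, hz⟩
    rw [hΦX, smul_smul] at hz
    obtain ⟨d, hd⟩ := exists_eq_smul_of_cutProductVec_eq_smul h0 hz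
    refine hf (Submodule.mem_span_singleton.2 ⟨d - t, ?_⟩)
    have hd : f + t • e = d • e := Subtype.ext hd
    rw [sub_smul, ← hd, add_sub_cancel_right]
  -- `X` is quadratic: the second difference of `t ↦ X (f + t • e)` at `-1, 0, 1` is twice its
  -- leading coefficient `X e`.
  have key : (2 : ℂ) • X e = X (f + (1 : ℂ) • e) + X (f + (-1 : ℂ) • e)
      - (2 : ℂ) • X (f + (0 : ℂ) • e) := by
    refine lp.ext (funext fun a => ?_)
    simp only [hX, lp.coeFn_smul, lp.coeFn_add, lp.coeFn_sub, Pi.smul_apply, Pi.add_apply,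
      Pi.sub_apply, smul_eq_mul, cutProductVec_apply, map_add, map_smul, Submodule.coe_add,
      Submodule.coe_smul]
    ring
  have hXe : X e ∈ W := (W.smul_mem_iff two_ne_zero).1
    (key ▸ W.sub_mem (W.add_mem (hW _) (hW _)) (W.smul_mem _ (hW _)))
  exact hΦW (hΦX ▸ W.smul_mem _ hXe)

end Classification

/-! ### Assembling the classes -/

section Classes

variable {k : ℕ} {ι : Fin k → Type*} {S : Submodule ℂ (HilbTensor ι)} [FiniteDimensional ℂ S]

theorem linearIndependent_of_span_eq {E : Type*} [AddCommGroup E] [Module ℂ E] {n : ℕ}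
    {f : Fin n → E} {T : Submodule ℂ E} (hT : Module.finrank ℂ T = n)
    (h : T = Submodule.span ℂ (Set.range f)) : LinearIndependent ℂ f := by
  rw [linearIndependent_iff_card_eq_finrank_span, Fintype.card_fin, Set.finrank, ← h, hT]

theorem range_fin_two {X : Type*} (f : Fin 2 → X) : Set.range f = {f 0, f 1} := by
  ext x
  simp [Fin.exists_fin_two, eq_comm]

theorem isEntangledClass_of_finrank_eq_zero (h : Module.finrank ℂ (sepSpan S) = 0) :
    IsEntangledClass S := by
  have : FiniteDimensional ℂ (sepSpan S) := Submodule.finiteDimensional_of_le (sepSpan_le S)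
  have h0 : ∀ ψ ∈ S, IsProductVector ψ → ψ = 0 := fun ψ hψ hp => by
    have := mem_sepSpan hψ hp
    rwa [Submodule.finrank_eq_zero.1 h, Submodule.mem_bot] at this
  refine ⟨h, h0, ?_⟩
  rw [separableStates_eq_convexHull, convexHull_eq_empty, Set.eq_empty_iff_forall_notMem]
  rintro _ ⟨ψ, ⟨hp, hψ⟩, h1, -⟩
  rw [h0 ψ hψ hp, norm_zero] at h1
  exact zero_ne_one h1

theorem isSinglePointClass_of_finrank_eq_one (h : Module.finrank ℂ (sepSpan S) = 1) :
    IsSinglePointClass S := by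
  obtain ⟨α, h1, hS, hspan⟩ := exists_unit_family h
  have hall : ∀ ψ ∈ S, IsProductVector ψ → ∃ c : ℂ, ψ = c • productVec (α 0) := by
    intro ψ hψ hp
    have := mem_sepSpan hψ hp
    rw [hspan, Set.range_unique] at this
    obtain ⟨c, hc⟩ := Submodule.mem_span_singleton.1 this
    exact ⟨c, hc.symm⟩
  refine ⟨h, α 0, h1 0, hS 0, hall, ?_⟩
  rw [separableStates_eq_convexHull_range h1 hS fun χ hχ hp => ⟨0, hall χ hχ hp⟩, Set.range_unique,
    convexHull_singleton]
  rfl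

theorem isSegmentClass_of_not_parallel {α : Fin 2 → ∀ j, Hilb (ι j)}
    (h : Module.finrank ℂ (sepSpan S) = 2) (h1 : ∀ i j, ‖α i j‖ = 1)
    (hS : ∀ i, productVec (α i) ∈ S)
    (hspan : sepSpan S = Submodule.span ℂ (Set.range fun i => productVec (α i))) {l m : Fin k}
    (hlm : l ≠ m) (hl : ¬ Parallel (α 0 l : ι l → ℂ) (α 1 l))
    (hm : ¬ Parallel (α 0 m : ι m → ℂ) (α 1 m)) : IsSegmentClass S α := by
  refine ⟨h, h1, hspan, ⟨l, m, hlm, linearIndependent_of_not_parallel hl,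
    linearIndependent_of_not_parallel hm⟩,
    separableStates_eq_convexHull_range h1 hS fun χ hχ hp => ?_⟩
  have := mem_sepSpan hχ hp
  rw [hspan, range_fin_two] at this
  rcases exists_eq_smul_of_mem_span_pair (h1 0) (h1 1) hlm hl hm hp this with h | h
  exacts [⟨0, h⟩, ⟨1, h⟩]

theorem isLocalQubitClass_of_parallelOff {α : Fin 2 → ∀ j, Hilb (ι j)}
    (h : Module.finrank ℂ (sepSpan S) = 2) (h1 : ∀ i j, ‖α i j‖ = 1)
    (hspan : sepSpan S = Submodule.span ℂ (Set.range fun i => productVec (α i))) {l : Fin k}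
    (hl : ParallelOff l (coeFamily (α 0)) (coeFamily (α 1))) : IsLocalQubitClass S := by
  have : FiniteDimensional ℂ (sepSpan S) := Submodule.finiteDimensional_of_le (sepSpan_le S)
  have hli := linearIndependent_of_span_eq h hspan
  have hlocal : sepSpan S
      = localSpace l (Submodule.span ℂ (Set.range fun i => α i l)) (α 0) := by
    rw [hspan, range_fin_two, range_fin_two, span_pair_eq_localSpace (h1 0) (h1 1) hl]
  have hprod : ∀ ψ ∈ sepSpan S, IsProductVector ψ := fun ψ hψ =>
    isProductVector_of_mem_localSpace (hlocal ▸ hψ)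
  refine ⟨h, α, h1, hspan, l, fun j hj => sameState_of_parallel (h1 0 j) (h1 1 j) (hl j hj),
    linearIndependent_of_not_parallel fun hp => ?_, hlocal, hprod, ?_⟩
  · obtain ⟨j, hj⟩ := exists_not_parallel_of_linearIndependent h1 hli (zero_ne_one (α := Fin 2))
    by_cases hjl : j = l
    · exact hj (hjl ▸ hp)
    · exact hj (hl j hjl)
  · rw [separableStates_eq_convexHull, densityOperators_eq_convexHull]
    congr 2
    ext ψ
    exact ⟨fun hψ => mem_sepSpan hψ.2 hψ.1, fun hψ => ⟨hprod ψ hψ, sepSpan_le S hψ⟩⟩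

theorem localQubit_or_segment_of_finrank_eq_two (hk : 0 < k)
    (h : Module.finrank ℂ (sepSpan S) = 2) :
    IsLocalQubitClass S ∨ ∃ α : Fin 2 → ∀ j, Hilb (ι j), IsSegmentClass S α := by
  obtain ⟨α, h1, hS, hspan⟩ := exists_unit_family h
  by_cases hc : ∃ l m, l ≠ m ∧ ¬ Parallel (α 0 l : ι l → ℂ) (α 1 l) ∧
      ¬ Parallel (α 0 m : ι m → ℂ) (α 1 m)
  · obtain ⟨l, m, hlm, hl, hm⟩ := hc
    exact Or.inr ⟨α, isSegmentClass_of_not_parallel h h1 hS hspan hlm hl hm⟩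
  · obtain ⟨l, hl⟩ := exists_parallelOff (φ := coeFamily (α 0)) (ψ := coeFamily (α 1)) hk
      fun l m hlm => by
        by_contra! hn
        exact hc ⟨l, m, hlm, hn⟩
    exact Or.inl (isLocalQubitClass_of_parallelOff h h1 hspan hl)

theorem isTriangle_or_isSphericalCone (hk : 3 ≤ k) {α : Fin 3 → ∀ j, Hilb (ι j)}
    (h1 : ∀ i j, ‖α i j‖ = 1) (hli : LinearIndependent ℂ fun i => productVec (α i))
    (hspan : S = Submodule.span ℂ (Set.range fun i => productVec (α i)))
    (hn : ∀ j, ∃ i i', ¬ Parallel (α i j : ι j → ℂ) (α i' j)) :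
    IsTriangle S α ∨ IsSphericalCone S α := by
  have hS : ∀ i, productVec (α i) ∈ S := fun i => hspan ▸ Submodule.subset_span ⟨i, rfl⟩
  rcases product_lines_or_local_qubit hk h1 hli hn with h | ⟨l, a, b, c, hab, hac, hbc, hp, h⟩
  · rw [← hspan] at h
    exact Or.inl (separableStates_eq_convexHull_range h1 hS h)
  · rw [← hspan] at h
    refine Or.inr ⟨l, a, b, c, hab, hac, hbc, sameState_productVecOff (h1 b) (h1 c) hp, ?_⟩
    rw [span_pair_eq_localSpace (h1 b) (h1 c) hp] at h
    have hle : localSpace l (Submodule.span ℂ {α b l, α c l}) (α b) ≤ S := by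
      rw [← span_pair_eq_localSpace (h1 b) (h1 c) hp, Submodule.span_le]
      rintro _ (rfl | rfl)
      exacts [hS b, hS c]
    have : FiniteDimensional ℂ (localSpace l (Submodule.span ℂ {α b l, α c l}) (α b)) :=
      Submodule.finiteDimensional_of_le hle
    have ha := norm_productVec_of_norm_eq_one (h1 a)
    rw [separableStates_eq_convexHull, densityOperators_eq_convexHull]
    refine Set.Subset.antisymm (convexHull_min ?_ (convex_convexHull ℝ _))
      (convexHull_min (Set.union_subset ?_ (convexHull_mono (pureStates_mono ?_)))
        (convex_convexHull ℝ _))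
    · rintro _ ⟨χ, ⟨hχp, hχ⟩, hχ1, rfl⟩
      refine subset_convexHull ℝ _ ?_
      rcases h χ hχ hχp with ⟨z, hz⟩ | hW
      · exact Or.inl (ketbra_eq_of_eq_smul hχ1 ha hz)
      · exact Or.inr (subset_convexHull ℝ _ ⟨χ, hW, hχ1, rfl⟩)
    · rintro _ rfl
      exact subset_convexHull ℝ _ ⟨_, ⟨⟨_, rfl⟩, hS a⟩, ha, rfl⟩
    · exact fun χ hχ => ⟨isProductVector_of_mem_localSpace hχ, hle hχ⟩

theorem not_isTwoQubitHull_and_not_isSymmetricHull (hk : 3 ≤ k) {α : Fin 3 → ∀ j, Hilb (ι j)}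
    (h1 : ∀ i j, ‖α i j‖ = 1) (hli : LinearIndependent ℂ fun i => productVec (α i))
    (hspan : S = Submodule.span ℂ (Set.range fun i => productVec (α i)))
    (hn : ∀ j, ∃ i i', ¬ Parallel (α i j : ι j → ℂ) (α i' j)) :
    ¬ IsTwoQubitHull (separableStates S) ∧ ¬ IsSymmetricHull (separableStates S) := by
  have hS : ∀ i, productVec (α i) ∈ S := fun i => hspan ▸ Submodule.subset_span ⟨i, rfl⟩
  -- Triangle and cone are put in one form, a line and the span of the other two product states; in
  -- the triangle case any labelling works.
  obtain ⟨a, b, c, hab, hac, h⟩ : ∃ a b c : Fin 3, a ≠ b ∧ a ≠ c ∧ ∀ χ ∈ S, IsProductVector χ →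
      (∃ z : ℂ, χ = z • productVec (α a)) ∨
        χ ∈ Submodule.span ℂ {productVec (α b), productVec (α c)} := by
    rcases product_lines_or_local_qubit hk h1 hli hn with h | ⟨l, a, b, c, hab, hac, -, -, h⟩
    · rw [← hspan] at h
      refine ⟨0, 1, 2, by decide, by decide, fun χ hχ hp => ?_⟩
      obtain ⟨i, z, hz⟩ := h χ hχ hp
      fin_cases i
      · exact Or.inl ⟨z, hz⟩
      · exact Or.inr (hz ▸ Submodule.smul_mem _ _ (Submodule.subset_span (by simp)))
      · exact Or.inr (hz ▸ Submodule.smul_mem _ _ (Submodule.subset_span (by simp)))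
    · exact ⟨a, b, c, hab, hac, hspan ▸ h⟩
  have hW : productVec (α a) ∉ Submodule.span ℂ {productVec (α b), productVec (α c)} := by
    have := hli.notMem_span_image (s := {b, c}) (x := a) (by simp [hab, hac])
    rwa [Set.image_pair] at this
  have hmem : ketbra (productVec (α a)) ∈ separableStates S := by
    rw [separableStates_eq_convexHull]
    exact subset_convexHull ℝ _ ⟨_, ⟨⟨_, rfl⟩, hS a⟩, norm_productVec_of_norm_eq_one (h1 a), rfl⟩
  have : FiniteDimensional ℂ (Submodule.span ℂ {productVec (α b), productVec (α c)}) :=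
    FiniteDimensional.span_of_finite ℂ (Set.toFinite _)
  exact ⟨not_isTwoQubitHull (by omega) hmem hW h, not_isSymmetricHull (by omega) hmem hW h⟩

end Classes

end Multipartite

end

theorem theorem3 {k : ℕ} (hk : 3 ≤ k) {ι : Fin k → Type*}
    (S : Submodule ℂ (HilbTensor ι)) (hS : Module.finrank ℂ S = 3) :
    (Module.finrank ℂ (sepSpan S) ≤ 2 →
      IsLocalQubitClass S ∨ IsOrthogonalSegmentClass S ∨ IsNonorthogonalSegmentClass S ∨
        IsSinglePointClass S ∨ IsEntangledClass S) ∧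
    (Module.finrank ℂ (sepSpan S) = 3 →
      sepSpan S = S ∧
      (∃ α : Fin 3 → ∀ j, Hilb (ι j), (∀ i j, ‖α i j‖ = 1) ∧
        S = Submodule.span ℂ (Set.range fun i => productVec (α i))) ∧
      ∀ α : Fin 3 → ∀ j, Hilb (ι j), (∀ i j, ‖α i j‖ = 1) →
        S = Submodule.span ℂ (Set.range fun i => productVec (α i)) →
        (∀ j, Module.finrank ℂ (Submodule.span ℂ (Set.range fun i => α i j)) ∈
          ({2, 3} : Set ℕ)) →
        (IsTriangle S α ∨ IsSphericalCone S α) ∧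
        ¬ IsTwoQubitHull (separableStates S) ∧
        ¬ IsSymmetricHull (separableStates S)) := by
  have : FiniteDimensional ℂ S := Module.finite_of_finrank_pos (by omega)
  refine ⟨fun h => ?_, fun h => ?_⟩
  · obtain h | h | h : Module.finrank ℂ (sepSpan S) = 2 ∨ Module.finrank ℂ (sepSpan S) = 1 ∨
        Module.finrank ℂ (sepSpan S) = 0 := by omega
    · rcases localQubit_or_segment_of_finrank_eq_two (by omega) h with h | ⟨α, hα⟩
      · exact Or.inl h
      · by_cases h0 : inner ℂ (productVec (α 0)) (productVec (α 1)) = 0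
        · exact Or.inr (Or.inl ⟨α, hα, h0⟩)
        · exact Or.inr (Or.inr (Or.inl ⟨α, hα, h0⟩))
    · exact Or.inr (Or.inr (Or.inr (Or.inl (isSinglePointClass_of_finrank_eq_one h))))
    · exact Or.inr (Or.inr (Or.inr (Or.inr (isEntangledClass_of_finrank_eq_zero h))))
  · have hsep : sepSpan S = S := Submodule.eq_of_le_of_finrank_eq (sepSpan_le S) (h.trans hS.symm)
    obtain ⟨α, h1, -, hspan⟩ := exists_unit_family h
    refine ⟨hsep, ⟨α, h1, hsep ▸ hspan⟩, fun α h1 hspan hα => ?_⟩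
    have hli := linearIndependent_of_span_eq hS hspan
    have hn := fun j => exists_not_parallel (fun i => h1 i j) (hα j)
    exact ⟨isTriangle_or_isSphericalCone hk h1 hli hspan hn,
      not_isTwoQubitHull_and_not_isSymmetricHull hk h1 hli hspan hn⟩
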